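/- Let $d,k,l\in\mathbb{N}$ with $k\ge 1$ and $l>2kd+1$. Let $\lambda_1,\ldots,\lambda_d\in\mathbb{C}$ have modulus $1$ and be one-resonant of index $(1,\ldots,1)$: for all $j\in\{1,\ldots,d\}$ and $m=(m_1,\ldots,m_d)\in\mathbb{N}^d$ (with $0\in\mathbb{N}$), $\lambda_j=\lambda_1^{m_1}\cdots\lambda_d^{m_d}$ if and only if $m=(q,\ldots,q)+e_j$ for some $q\in\mathbb{N}$. Let $F$ be a germ of automorphisms of $\mathbb{C}^d$ at the origin of the form $$F(z)=(\lambda_1z^1,\ldots,\lambda_dz^d)\Bigl(1-\frac{(z^1\cdots z^d)^k}{kd}\Bigr)+O(\|z\|^l),$$ represented by a holomorphic map on an open neighbourhood $U$ of $0$. Let $\beta_0\in(0,1/d)$ with $\beta_0(l+d-1)>2k+1$, and $\theta_0\in(0,\tfrac{\pi}{2k})$. For $R_0>0$ and $h\in\{0,\ldots,k-1\}$ let $B_h=B_h(R_0,\theta_0,\beta_0)$ be the set of all $z\in\mathbb{C}^d$ such that $u=z^1\cdots z^d$ satisfies $$\Bigl|u^k-\tfrac1{2R_0}\Bigr|<\tfrac1{2R_0},\qquad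 \bigl|\arg(u)-\tfrac{2\pi h}{k}\bigr|<\theta_0\ (\text{arguments modulo }2\pi),\qquad |z^j|<|u|^{\beta_0}\ \text{for } j=1,\ldots,d.$$ Call $B_h$ a uniform local basin of $F$ if $B_h\subseteq U$, $F(B_h)\subseteq B_h$, and $F^n\to0$ uniformly on $B_h$. Write $|z|=(|z^1|,\ldots,|z^d|)$ and $z_n=F^n(z)$. There exists $R_0>0$ such that $B_0,\ldots,B_{k-1}$ are uniform local basins of $F$. Moreover, for every $R_0>0$ and $h\in\{0,\ldots,k-1\}$ such that $B_h=B_h(R_0,\theta_0,\beta_0)$ is a uniform local basin of $F$: (1) For every $z\in B_h$ the limit $v(z):=\lim_{n\to\infty}|z_n|/\|z_n\|_2$ exists and is a unit vector with positive entries. The set of accumulation points of the sequence of directions $(z_n/\|z_n\|_2)_n$ is $$\omega(z)=\{w\in\mathbb{C}^d : |w|=v(z),\ \arg w^1+\cdots+\arg w^d\equiv 2\pi h/k \pmod{2\pi}\}.$$ In other words, $z_n\to 0$ tangent to the linear cone $\mathbb{R}_0^+\cdot\omega(z)$, i.e. the distance of $z_n$ to this cone is $o(\|z_n\|_2)$.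 (2) For every unit vector $v\in\mathbb{R}^d$ with positive entries there exists $z\in B_h$ with $v(z)=v$. (3) The set of all accumulation points of directions of orbits in $B_h$ is $$\{w\in(\mathbb{C}\setminus\{0\})^d : \|w\|_2=1,\ \arg w^1+\cdots+\arg w^d\equiv 2\pi h/k \pmod{2\pi}\}.$$ -/

import Mathlib

open Filter Topology Asymptotics

noncomputable section

/-- `z^1 ⋯ z^d`. -/
def coordProd {d : ℕ} (z : EuclideanSpace ℂ (Fin d)) : ℂ := ∏ j, z j

/-- The multipliers `lam` are one-resonant of index `α`: the relation `lam_j = lam^m`, with `m` a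
multi-index of natural numbers, holds if and only if `m = q α + e_j` for some `q`. -/
def IsOneResonant {d : ℕ} (lam : Fin d → ℂ) (α : Fin d → ℕ) : Prop :=
  ∀ (j : Fin d) (m : Fin d → ℕ),
    lam j = ∏ i, lam i ^ m i ↔ ∃ q : ℕ, m = q • α + Pi.single j 1

/-- The normal form `z ↦ Λ z (1 - (z^1 ⋯ z^d)^k / (k d))`. -/
def normalForm {d : ℕ} (lam : Fin d → ℂ) (k : ℕ) (z : EuclideanSpace ℂ (Fin d)) :
    EuclideanSpace ℂ (Fin d) :=
  WithLp.toLp 2 fun j => lam j * z j * (1 - coordProd z ^ k / ((k : ℂ) * (d : ℂ)))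

/-- The sector `S_h(R, θ)`. The argument is an element of `ℝ / 2πℤ`, and its distance to
`2πh/k` is the absolute value of the representative of the difference in `(-π, π]`. -/
def attractingSector (k h : ℕ) (R θ : ℝ) : Set ℂ :=
  {u | ‖u ^ k - 1 / (2 * (R : ℂ))‖ < 1 / (2 * R) ∧
    |((Complex.arg u : Real.Angle) - ((2 * Real.pi * h / k : ℝ) : Real.Angle)).toReal| < θ}

/-- The set `W(β)`. -/
def modulusRegion (d : ℕ) (β : ℝ) : Set (EuclideanSpace ℂ (Fin d)) :=
  {z | ∀ j, ‖z j‖ < ‖coordProd z‖ ^ β}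

/-- The set `B_h(R, θ, β)`. -/
def localBasin (d k h : ℕ) (R θ β : ℝ) : Set (EuclideanSpace ℂ (Fin d)) :=
  {z | z ∈ modulusRegion d β ∧ coordProd z ∈ attractingSector k h R θ}

/-- `B` is a uniform local basin of attraction to the origin of the map `F` defined on `U`. -/
def IsUniformLocalBasin {d : ℕ}
    (F : EuclideanSpace ℂ (Fin d) → EuclideanSpace ℂ (Fin d))
    (U B : Set (EuclideanSpace ℂ (Fin d))) : Prop :=
  B ⊆ U ∧ Set.MapsTo F B B ∧ TendstoUniformlyOn (fun n => F^[n]) (fun _ => 0) atTop B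

/-- `|z| = (|z^1|, …, |z^d|)`. -/
def modulusVector {d : ℕ} (z : EuclideanSpace ℂ (Fin d)) : EuclideanSpace ℝ (Fin d) :=
  WithLp.toLp 2 fun j => ‖z j‖

/-- The direction `z_n / ‖z_n‖₂` of the `n`-th iterate of `z`. -/
def orbitDirection {d : ℕ} (F : EuclideanSpace ℂ (Fin d) → EuclideanSpace ℂ (Fin d))
    (z : EuclideanSpace ℂ (Fin d)) (n : ℕ) : EuclideanSpace ℂ (Fin d) :=
  ((‖F^[n] z‖⁻¹ : ℝ) : ℂ) • F^[n] z

/-- `v(z) = v`, i.e. `|z_n| / ‖z_n‖₂` converges to `v`. -/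
def HasModulusDirection {d : ℕ} (F : EuclideanSpace ℂ (Fin d) → EuclideanSpace ℂ (Fin d))
    (z : EuclideanSpace ℂ (Fin d)) (v : EuclideanSpace ℝ (Fin d)) : Prop :=
  Tendsto (fun n => ‖F^[n] z‖⁻¹ • modulusVector (F^[n] z)) atTop (𝓝 v)

/-- The set of accumulation points (limits of subsequences) of the directions of the orbit. -/
def directionLimitSet {d : ℕ} (F : EuclideanSpace ℂ (Fin d) → EuclideanSpace ℂ (Fin d))
    (z : EuclideanSpace ℂ (Fin d)) : Set (EuclideanSpace ℂ (Fin d)) :=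
  {w | MapClusterPt w atTop (orbitDirection F z)}

/-- `arg w^1 + ⋯ + arg w^d ≡ 2πh/k` modulo `2π`. -/
def ArgSumCongr {d : ℕ} (k h : ℕ) (w : EuclideanSpace ℂ (Fin d)) : Prop :=
  ∑ j, (Complex.arg (w j) : Real.Angle) = ((2 * Real.pi * h / k : ℝ) : Real.Angle)

/-- `{w | |w| = v, arg w^1 + ⋯ + arg w^d ≡ 2πh/k}`. -/
def phaseTorus {d : ℕ} (k h : ℕ) (v : EuclideanSpace ℝ (Fin d)) :
    Set (EuclideanSpace ℂ (Fin d)) :=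
  {w | modulusVector w = v ∧ ArgSumCongr k h w}

/-- The linear cone `ℝ₀⁺ · A`. -/
def realCone {d : ℕ} (A : Set (EuclideanSpace ℂ (Fin d))) : Set (EuclideanSpace ℂ (Fin d)) :=
  {x | ∃ t : ℝ, 0 ≤ t ∧ ∃ w ∈ A, x = (t : ℂ) • w}

/-- The orbit of `z` converges to `0` tangent to the cone `C`. -/
def ConvergesTangentTo {d : ℕ} (F : EuclideanSpace ℂ (Fin d) → EuclideanSpace ℂ (Fin d))
    (z : EuclideanSpace ℂ (Fin d)) (C : Set (EuclideanSpace ℂ (Fin d))) : Prop :=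
  Tendsto (fun n => F^[n] z) atTop (𝓝 0) ∧
    (fun n => Metric.infDist (F^[n] z) C) =o[atTop] (fun n => ‖F^[n] z‖)

end

noncomputable section

/-! ### Kronecker's theorem -/

/-! Write `u = z^1 ⋯ z^d` and `y = u^k`. One step multiplies the `j`-th coordinate by `lam j * (1 -
y/(kd)) * (1 + ρ_j)`, where the middle factor is common to all coordinates. The hypothesis on `β₀ (l
+ d - 1)` makes `ρ_j = O(|y|^2)` (`exists_relErr_bound`). Since `∏ lam j = 1`, the multipliers drop
out of `u`, and `Y = 1/y` moves by `Y ↦ Y + 1 + O(|y|)`. For small `y` this preserves the cone given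
by `θ₀`, and `β₀ d < 1` preserves the condition on the moduli; this gives the uniform basins
(`exists_stepEstimate`).

Along an orbit `|y_n| = O(1/n)`, so the logarithms of `1 + ρ_j` are summable. Moreover `Y_n / n →
1`, so the argument of `u_n` tends to `2πh/k`, and this forces the phase accumulated by the common
factor to converge. Hence `lam^{-n} z_n`, rescaled by positive reals common to all coordinates,
converges to a vector `c` with nonzero entries whose product has argument `2πh/k` (`exists_phase`).

Directions are therefore asymptotic to `lam^n c / ‖c‖`. Their moduli converge, and one-resonance
leaves no multiplicative relation among the `lam j` other than powers of `∏ lam j = 1`, so by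
Kronecker's theorem the powers `lam^n` are dense in the torus `∏ g = 1`
(`IsOneResonant.mapClusterPt_pow`, `HasPhase.conclusion`).

To realize a prescribed `v`, use `|c j| = |z j| exp (Re errLog_j)`. Deep in the basin `errLog` is
small and holomorphic, so in logarithmic coordinates the equation is a small perturbation of the
identity and a contraction solves it (`exists_add_re_eq`, `exists_mem_norm_mul_exp_eq`). An
arbitrary uniform basin reduces to a deep one because its orbits tend to `0`. -/

instance {ι : Type*} [Fintype ι] :
    MeasureTheory.IsProbabilityMeasure (MeasureTheory.volume : MeasureTheory.Measure (UnitAddTorus ι)) := by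
  refine ⟨?_⟩
  simp [MeasureTheory.volume_pi, UnitAddTorus, MeasureTheory.Measure.pi_univ]

open MeasureTheory UnitAddTorus in
-- By translation invariance, shifting by `a` multiplies the integral by `mFourier m a ≠ 1` without
-- changing it.
lemma integral_mFourier_eq_zero {ι : Type*} [Fintype ι] {a : UnitAddTorus ι} {m : ι → ℤ}
    (h : mFourier m a ≠ 1) : ∫ x, mFourier m x = 0 := by
  have hadd : ∀ x, mFourier m (x + a) = mFourier m x * mFourier m a := by
    intro x
    simp only [mFourier, ContinuousMap.coe_mk, ← Finset.prod_mul_distrib]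
    refine Finset.prod_congr rfl fun i _ => ?_
    simp [fourier_apply, smul_add, AddCircle.toCircle_add]
  have h1 : ∫ x, mFourier m (x + a) = ∫ x, mFourier m x := integral_add_right_eq_self _ a
  simp only [hadd] at h1
  rw [integral_mul_const] at h1
  have h2 : (∫ x, mFourier m x) * (mFourier m a - 1) = 0 := by rw [mul_sub, h1]; ring
  exact (mul_eq_zero.1 h2).resolve_right (sub_ne_zero.2 h)

lemma UnitAddTorus.mFourier_nsmul {ι : Type*} [Fintype ι] (a : UnitAddTorus ι) (m : ι → ℤ) (n : ℕ) :
    mFourier m (n • a) = mFourier m a ^ n := by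
  simp only [mFourier, ContinuousMap.coe_mk, ← Finset.prod_pow]
  refine Finset.prod_congr rfl fun i _ => ?_
  rw [Pi.smul_apply, fourier_apply, fourier_apply, smul_comm, AddCircle.toCircle_nsmul]
  simp

lemma tendsto_average_pow {w : ℂ} (hw : ‖w‖ = 1) (h1 : w ≠ 1) :
    Tendsto (fun N : ℕ => (N : ℝ)⁻¹ • ∑ n ∈ Finset.range N, w ^ n) atTop (𝓝 0) := by
  have hb : Tendsto (fun N : ℕ => (N : ℝ)⁻¹ * (2 / ‖w - 1‖)) atTop (𝓝 0) := by
    simpa using (tendsto_inv_atTop_nhds_zero_nat (𝕜 := ℝ)).mul_const (2 / ‖w - 1‖)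
  refine squeeze_zero_norm (fun N => ?_) hb
  rw [norm_smul, geom_sum_eq h1, norm_div, Real.norm_of_nonneg (by positivity)]
  gcongr
  calc ‖w ^ N - 1‖ ≤ ‖w ^ N‖ + ‖(1 : ℂ)‖ := norm_sub_le _ _
    _ = 2 := by rw [norm_pow, hw]; norm_num

open MeasureTheory UnitAddTorus in
/-- Weyl's equidistribution theorem on a torus. -/
lemma tendsto_average_nsmul {ι : Type*} [Fintype ι] {a : UnitAddTorus ι}
    (h : ∀ m : ι → ℤ, m ≠ 0 → mFourier m a ≠ 1) (f : C(UnitAddTorus ι, ℂ)) :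
    Tendsto (fun N : ℕ => (N : ℝ)⁻¹ • ∑ n ∈ Finset.range N, f (n • a)) atTop
      (𝓝 (∫ x, f x)) := by
  have hint : ∀ g : C(UnitAddTorus ι, ℂ), Integrable (fun x => g x) := fun g =>
    g.continuous.integrable_of_hasCompactSupport (HasCompactSupport.of_compactSpace _)
  have hspan : ∀ g ∈ Submodule.span ℂ (Set.range (mFourier (d := ι))),
      Tendsto (fun N : ℕ => (N : ℝ)⁻¹ • ∑ n ∈ Finset.range N, g (n • a)) atTop
        (𝓝 (∫ x, g x)) := by
    intro g hg
    induction hg using Submodule.span_induction with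
    | mem g hg =>
      obtain ⟨m, rfl⟩ := hg
      simp only [mFourier_nsmul]
      by_cases hm : m = 0
      · subst hm
        refine tendsto_const_nhds.congr' ?_
        filter_upwards [eventually_gt_atTop 0] with N hN
        have : (N : ℂ) ≠ 0 := by exact_mod_cast hN.ne'
        simp [mFourier_zero, this]
      · rw [integral_mFourier_eq_zero (h m hm)]
        refine tendsto_average_pow ?_ (h m hm)
        simp [mFourier, fourier_apply, norm_prod, Circle.norm_coe]
    | zero => simp
    | add g g' _ _ hg hg' =>
      have := hg.add hg'
      simp only [← smul_add, ← Finset.sum_add_distrib] at this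
      simpa only [ContinuousMap.add_apply, integral_add (hint g) (hint g')] using this
    | smul c g _ hg =>
      have := hg.const_smul c
      simp only [smul_comm c, Finset.smul_sum] at this
      simpa only [ContinuousMap.smul_apply, integral_smul, Finset.smul_sum] using this
  -- Averaging and integrating are both 1-Lipschitz for the uniform norm, so convergence passes from
  -- trigonometric polynomials to their closure, which is everything.
  have hf : f ∈ closure (Submodule.span ℂ (Set.range (mFourier (d := ι))) : Set C(UnitAddTorus ι, ℂ)) := by
    have := span_mFourier_closure_eq_top (d := ι)
    rw [← Submodule.topologicalClosure_coe, this]; trivial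
  rw [Metric.tendsto_atTop]
  intro ε hε
  obtain ⟨g, hg, hfg⟩ := Metric.mem_closure_iff.1 hf (ε / 3) (by positivity)
  obtain ⟨N₀, hN₀⟩ := Metric.tendsto_atTop.1 (hspan g hg) (ε / 3) (by positivity)
  have hpt : ∀ x, ‖f x - g x‖ ≤ ε / 3 := fun x => by
    rw [← dist_eq_norm]; exact (ContinuousMap.dist_apply_le_dist x).trans hfg.le
  refine ⟨N₀, fun N hN => ?_⟩
  have h1 : dist ((N : ℝ)⁻¹ • ∑ n ∈ Finset.range N, f (n • a))
      ((N : ℝ)⁻¹ • ∑ n ∈ Finset.range N, g (n • a)) ≤ ε / 3 := by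
    rw [dist_eq_norm, ← smul_sub, ← Finset.sum_sub_distrib, norm_smul,
      Real.norm_of_nonneg (by positivity)]
    rcases N.eq_zero_or_pos with rfl | hN0
    · simp; positivity
    have hN' : (0 : ℝ) < N := by exact_mod_cast hN0
    rw [inv_mul_le_iff₀ hN']
    refine (norm_sum_le_of_le _ fun n _ => hpt (n • a)).trans ?_
    simp
  have h2 : dist (∫ x, g x) (∫ x, f x) ≤ ε / 3 := by
    rw [dist_comm, dist_eq_norm, ← integral_sub (hint f) (hint g)]
    simpa using norm_integral_le_of_norm_le_const (μ := (volume : Measure (UnitAddTorus ι)))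
      (Eventually.of_forall hpt)
  have h3 := hN₀ N hN
  calc _ ≤ _ := dist_triangle4 _ ((N : ℝ)⁻¹ • ∑ n ∈ Finset.range N, g (n • a)) (∫ x, g x) _
    _ < ε := by linarith

open MeasureTheory UnitAddTorus in
/-- Kronecker's theorem. -/
lemma mapClusterPt_nsmul {ι : Type*} [Fintype ι] {a : UnitAddTorus ι}
    (h : ∀ m : ι → ℤ, m ≠ 0 → mFourier m a ≠ 1) (b : UnitAddTorus ι) :
    MapClusterPt b atTop (fun n : ℕ => n • a) := by
  rw [Metric.nhds_basis_ball.mapClusterPt_iff_frequently]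
  intro ε hε
  by_contra hcon
  rw [not_frequently] at hcon
  -- A tent supported in the ball of radius `ε` about `b`. If the orbit eventually avoided that
  -- ball, the averages of the tent would tend to `0`, whereas its integral is positive.
  let φ : UnitAddTorus ι → ℝ := fun x => max 0 (ε - dist x b)
  have hφ : Continuous φ := by fun_prop
  let f : C(UnitAddTorus ι, ℂ) := ⟨fun x => (φ x : ℂ), by fun_prop⟩
  have h0 : Tendsto (fun n : ℕ => f (n • a)) atTop (𝓝 0) := by
    refine tendsto_const_nhds.congr' ?_
    filter_upwards [hcon] with n hn
    have : ε ≤ dist (n • a) b := by simpa using hn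
    simp [f, φ, this]
  have h1 := tendsto_nhds_unique (tendsto_average_nsmul h f) h0.cesaro_smul
  have h2 : 0 < ∫ x, φ x := by
    refine hφ.integral_pos_of_hasCompactSupport_nonneg_nonzero
      (HasCompactSupport.of_compactSpace _) (fun x => le_max_left _ _) (x := b) ?_
    simp [φ, hε.ne', hε.le]
  have h3 : ∫ x, f x = ((∫ x, φ x : ℝ) : ℂ) := integral_ofReal
  rw [h3] at h1
  exact h2.ne' (by exact_mod_cast h1)

lemma exists_toCircle_eq {c : ℂ} (hc : ‖c‖ = 1) : ∃ a : UnitAddCircle, (a.toCircle : ℂ) = c := by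
  refine ⟨(AddCircle.homeomorphCircle one_ne_zero).symm ⟨c, mem_sphere_zero_iff_norm.2 hc⟩, ?_⟩
  rw [← AddCircle.homeomorphCircle_apply one_ne_zero]
  exact congrArg Subtype.val (Homeomorph.apply_symm_apply _ _)

/-- The case `q = 1` of the resonance reads `lam j = (∏ lam) * lam j`. -/
lemma IsOneResonant.prod_eq_one {d : ℕ} {lam : Fin d → ℂ} (hres : IsOneResonant lam 1)
    (hlam : ∀ j, ‖lam j‖ = 1) : ∏ j, lam j = 1 := by
  rcases isEmpty_or_nonempty (Fin d) with h | ⟨⟨j⟩⟩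
  · simp
  have h1 := (hres j (1 + Pi.single j 1)).2 ⟨1, by simp⟩
  have h0 : lam j ≠ 0 := fun h => by simpa [h] using hlam j
  simp only [Pi.add_apply, Pi.one_apply, pow_add, pow_one, Finset.prod_mul_distrib] at h1
  have h2 : ∏ i, lam i ^ (Pi.single j 1 : Fin d → ℕ) i = lam j := by
    rw [Finset.prod_eq_single j] <;> simp +contextual
  rw [h2] at h1
  exact (mul_right_cancel₀ h0 (by rw [one_mul]; exact h1)).symm

/-- Adding a large constant `M` to every exponent makes them natural numbers and costs nothing, as
`∏ lam = 1`. Resonance then forces all exponents to be equal, and the vanishing entry `m j₀` makes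
the common value `0`. Thus the multipliers other than `lam j₀` are multiplicatively independent. -/
lemma IsOneResonant.eq_zero_of_prod_zpow_eq_one {d : ℕ} {lam : Fin d → ℂ}
    (hres : IsOneResonant lam 1) (hlam : ∀ j, ‖lam j‖ = 1) {m : Fin d → ℤ} {j₀ : Fin d}
    (hm₀ : m j₀ = 0) (hm : ∏ j, lam j ^ m j = 1) : m = 0 := by
  have h0 : ∀ j, lam j ≠ 0 := fun j h => by simpa [h] using hlam j
  let M : ℕ := ∑ j, (m j).natAbs
  have hM : ∀ j, 0 ≤ m j + M := by
    intro j
    have : (m j).natAbs ≤ M := Finset.single_le_sum (f := fun j => (m j).natAbs)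
      (fun _ _ => Nat.zero_le _) (Finset.mem_univ j)
    omega
  let m' : Fin d → ℕ := fun j => (m j + M).toNat
  have hm' : ∀ j, (m' j : ℤ) = m j + M := fun j => Int.toNat_of_nonneg (hM j)
  have h1 : ∏ j, lam j ^ m' j = 1 := by
    have : ∀ j, lam j ^ m' j = lam j ^ m j * lam j ^ M := by
      intro j
      rw [← zpow_natCast, hm', zpow_add₀ (h0 j), zpow_natCast]
    simp only [this, Finset.prod_mul_distrib, hm, Finset.prod_pow, hres.prod_eq_one hlam, one_pow,
      mul_one]
  obtain ⟨q, hq⟩ := (hres j₀ (m' + Pi.single j₀ 1)).1 (by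
    simp only [Pi.add_apply, pow_add, Finset.prod_mul_distrib, h1, one_mul]
    rw [Finset.prod_eq_single j₀] <;> simp +contextual)
  have hq' : ∀ j, m' j = q := fun j => by simpa using congrFun (add_right_cancel hq) j
  funext j
  have h2 := hm' j
  have h3 := hm' j₀
  rw [hq'] at h2 h3
  simp only [Pi.zero_apply]
  omega

/-- The powers of one-resonant multipliers of index `(1, …, 1)` cluster at every point of the
torus `∏ g = 1`. -/
lemma IsOneResonant.mapClusterPt_pow {d : ℕ} {lam : Fin d → ℂ} (hres : IsOneResonant lam 1)
    (hlam : ∀ j, ‖lam j‖ = 1) (j₀ : Fin d) {g : Fin d → ℂ}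
    (hg : ∀ j, ‖g j‖ = 1) (hgp : ∏ j, g j = 1) :
    MapClusterPt g atTop (fun (n : ℕ) j => lam j ^ n) := by
  classical
  have hprod := hres.prod_eq_one hlam
  choose a ha using fun j => exists_toCircle_eq (hlam j)
  choose b hb using fun j => exists_toCircle_eq (hg j)
  let a' : UnitAddTorus {j // j ≠ j₀} := fun j => a j
  let b' : UnitAddTorus {j // j ≠ j₀} := fun j => b j
  -- `Φ` parametrizes the torus `∏ g = 1` by the coordinates other than `j₀`. Kronecker's theorem
  -- applies to these free coordinates and is transported by continuity.
  let Φ : UnitAddTorus {j // j ≠ j₀} → Fin d → ℂ := fun x j =>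
    if h : j ≠ j₀ then ((x ⟨j, h⟩).toCircle : ℂ) else (∏ i, ((x i).toCircle : ℂ))⁻¹
  have hcirc : Continuous (fun y : UnitAddCircle => (y.toCircle : ℂ)) :=
    continuous_induced_dom.comp AddCircle.continuous_toCircle
  have hΦ : Continuous Φ := by
    refine continuous_pi fun j => ?_
    by_cases h : j ≠ j₀
    · refine (hcirc.comp (continuous_apply (⟨j, h⟩ : {j // j ≠ j₀}))).congr fun x => ?_
      simp only [Φ]
      rw [dif_pos h]
      rfl
    · refine ((continuous_finsetProd Finset.univ fun i _ => hcirc.comp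
        (continuous_apply (i : {j // j ≠ j₀}))).inv₀ fun x => ?_).congr fun x => ?_
      · exact Finset.prod_ne_zero_iff.2 fun i _ => Circle.coe_ne_zero _
      · simp only [Φ]
        rw [dif_neg h]
        simp
  have hΦ' : ∀ (x : UnitAddTorus {j // j ≠ j₀}) (w : Fin d → ℂ), ∏ j, w j = 1 →
      (∀ i : {j // j ≠ j₀}, ((x i).toCircle : ℂ) = w i) → Φ x = w := by
    intro x w hw hxw
    funext j
    by_cases h : j ≠ j₀
    · exact (dif_pos h).trans (hxw ⟨j, h⟩)
    · refine (dif_neg h).trans ?_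
      push Not at h
      subst h
      rw [Fintype.prod_eq_mul_prod_subtype_ne w j] at hw
      simp only [hxw]
      exact (eq_inv_of_mul_eq_one_left hw).symm
  have key := (mapClusterPt_nsmul (a := a') (fun m hm h1 => hm ?_) b').continuousAt_comp hΦ.continuousAt
  · rw [hΦ' b' g hgp fun i => hb i] at key
    convert key using 1
    funext n
    refine (hΦ' (n • a') (fun j => lam j ^ n) ?_ fun i => ?_).symm
    · rw [Finset.prod_pow, hprod, one_pow]
    · simp [a', AddCircle.toCircle_nsmul, ha]
  · let m' : Fin d → ℤ := fun j => if h : j ≠ j₀ then m ⟨j, h⟩ else 0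
    have := hres.eq_zero_of_prod_zpow_eq_one hlam (m := m') (j₀ := j₀) (by simp [m']) ?_
    · funext i
      have := congrFun this i
      simpa [m', i.2] using this
    · rw [Fintype.prod_eq_mul_prod_subtype_ne _ j₀, ← h1]
      simp only [m', UnitAddTorus.mFourier, ContinuousMap.coe_mk, fourier_apply,
        AddCircle.toCircle_zsmul, a']
      simp [ha]
      exact Finset.prod_congr rfl fun x _ => if_neg x.2

/-! ### Sectors in logarithmic coordinates -/

lemma abs_arg_lt_iff {w : ℂ} (hw : w ≠ 0) {φ : ℝ} (hφ0 : 0 < φ) (hφ : φ < Real.pi / 2) :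
    |w.arg| < φ ↔ 0 < w.re ∧ |w.im| < Real.tan φ * w.re := by
  have hφm : φ ∈ Set.Ioo (-(Real.pi / 2)) (Real.pi / 2) := ⟨by linarith, hφ⟩
  have hφm' : -φ ∈ Set.Ioo (-(Real.pi / 2)) (Real.pi / 2) := ⟨by linarith, by linarith⟩
  have key : 0 < w.re → (|w.arg| < φ ↔ |w.im| < Real.tan φ * w.re) := by
    intro hre
    have ha := abs_lt.1 (Complex.abs_arg_lt_pi_div_two_iff.2 (Or.inl hre))
    have ham : w.arg ∈ Set.Ioo (-(Real.pi / 2)) (Real.pi / 2) := ha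
    rw [abs_lt, ← Real.strictMonoOn_tan.lt_iff_lt ham hφm,
      ← Real.strictMonoOn_tan.lt_iff_lt hφm' ham, Complex.tan_arg, Real.tan_neg, div_lt_iff₀ hre,
      lt_div_iff₀ hre, abs_lt, neg_mul]
  constructor
  · intro h
    have hre : 0 < w.re :=
      (Complex.abs_arg_lt_pi_div_two_iff.1 (h.trans hφ)).resolve_right hw
    exact ⟨hre, (key hre).1 h⟩
  · rintro ⟨hre, h⟩
    exact (key hre).2 h

/-- Inversion turns the disc with diameter `(0, 1/R)` into a half-plane, the natural domain for a
map close to `Y ↦ Y + 1`. -/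
lemma norm_sub_lt_iff_lt_re_inv {y : ℂ} {R : ℝ} (hR : 0 < R) :
    ‖y - 1 / (2 * (R : ℂ))‖ < 1 / (2 * R) ↔ y ≠ 0 ∧ R < (y⁻¹).re := by
  have h1 : (1 / (2 * (R : ℂ))) = ((1 / (2 * R) : ℝ) : ℂ) := by push_cast; rfl
  rw [h1]
  have h2 : ‖y - ((1 / (2 * R) : ℝ) : ℂ)‖ < 1 / (2 * R) ↔ R * Complex.normSq y < y.re := by
    rw [← sq_lt_sq₀ (norm_nonneg _) (by positivity), ← Complex.normSq_eq_norm_sq,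
      Complex.normSq_apply, Complex.normSq_apply]
    simp only [Complex.sub_re, Complex.sub_im, Complex.ofReal_re, Complex.ofReal_im]
    have : (y.re - 1 / (2 * R)) * (y.re - 1 / (2 * R)) + (y.im - 0) * (y.im - 0)
        = (R * (y.re * y.re + y.im * y.im) - y.re) / R + (1 / (2 * R)) ^ 2 := by
      field_simp; ring
    rw [this, add_lt_iff_neg_right, div_lt_iff₀ hR, zero_mul, sub_neg]
  rw [h2, Complex.inv_re]
  constructor
  · intro h
    have hy : y ≠ 0 := by rintro rfl; simp at h
    exact ⟨hy, by rwa [lt_div_iff₀ (Complex.normSq_pos.2 hy)]⟩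
  · rintro ⟨hy, h⟩
    rwa [lt_div_iff₀ (Complex.normSq_pos.2 hy)] at h

/-- The rotation by `2πh/k`. -/
def sectorDir (k h : ℕ) : ℂ := Complex.exp (((2 * Real.pi * h / k : ℝ) : ℂ) * Complex.I)

/-- The logarithm of `u` turned back by `2πh/k`. -/
def sectorLog (k h : ℕ) (u : ℂ) : ℂ := Complex.log (u / sectorDir k h)

lemma sectorDir_ne_zero (k h : ℕ) : sectorDir k h ≠ 0 := Complex.exp_ne_zero _

lemma norm_sectorDir (k h : ℕ) : ‖sectorDir k h‖ = 1 := Complex.norm_exp_ofReal_mul_I _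

lemma arg_sectorDir (k h : ℕ) :
    ((sectorDir k h).arg : Real.Angle) = ((2 * Real.pi * h / k : ℝ) : Real.Angle) := by
  rw [sectorDir, Complex.exp_mul_I]
  have := Complex.arg_cos_add_sin_mul_I_coe_angle ((2 * Real.pi * h / k : ℝ) : Real.Angle)
  simpa using this

lemma sectorDir_pow {k : ℕ} (hk : 1 ≤ k) (h : ℕ) : sectorDir k h ^ k = 1 := by
  have hk' : (k : ℂ) ≠ 0 := by exact_mod_cast (by omega : k ≠ 0)
  rw [sectorDir, ← Complex.exp_nat_mul]
  convert Complex.exp_nat_mul_two_pi_mul_I h using 2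
  push_cast
  field_simp

lemma exp_sectorLog (k h : ℕ) {u : ℂ} (hu : u ≠ 0) :
    Complex.exp (sectorLog k h u) = u / sectorDir k h :=
  Complex.exp_log (div_ne_zero hu (sectorDir_ne_zero k h))

lemma exp_neg_mul_sectorLog {k : ℕ} (hk : 1 ≤ k) (h : ℕ) {u : ℂ} (hu : u ≠ 0) :
    Complex.exp (-(k * sectorLog k h u)) = (u ^ k)⁻¹ := by
  rw [Complex.exp_neg, Complex.exp_nat_mul, exp_sectorLog k h hu, div_pow, sectorDir_pow hk, div_one]

lemma sectorLog_mul_exp (k h : ℕ) {u s : ℂ} (hu : u ≠ 0)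
    (hs : |(sectorLog k h u + s).im| < Real.pi) :
    sectorLog k h (u * Complex.exp s) = sectorLog k h u + s := by
  have h1 : u * Complex.exp s / sectorDir k h = Complex.exp (sectorLog k h u + s) := by
    rw [Complex.exp_add, exp_sectorLog k h hu]; ring
  rw [abs_lt] at hs
  rw [sectorLog, h1, Complex.log_exp hs.1 hs.2.le]

lemma mem_attractingSector_iff {k h : ℕ} {R θ : ℝ} (hk : 1 ≤ k) (hR : 0 < R) {u : ℂ} :
    u ∈ attractingSector k h R θ ↔
      u ≠ 0 ∧ R < ((u ^ k)⁻¹).re ∧ |(sectorLog k h u).im| < θ := by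
  have hk' : k ≠ 0 := by omega
  rw [attractingSector, Set.mem_ofPred_eq, norm_sub_lt_iff_lt_re_inv hR, and_assoc,
    pow_ne_zero_iff hk']
  refine and_congr_right fun hu => and_congr_right fun _ => ?_
  rw [← arg_sectorDir, ← Complex.arg_div_coe_angle hu (sectorDir_ne_zero k h),
    Complex.arg_coe_angle_toReal_eq_arg, sectorLog, Complex.log_im]

lemma arg_exp_of_abs_im_lt {w : ℂ} (hw : |w.im| < Real.pi) : (Complex.exp w).arg = w.im := by
  rw [abs_lt] at hw
  rw [← Complex.log_im, Complex.log_exp hw.1 hw.2.le]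

/-- On `|Im L| < π / k`, the sector `|Im L| < θ` is a cone in the coordinate `exp (-k L)`. -/
lemma abs_im_lt_iff_cone {k : ℕ} (hk : 1 ≤ k) {θ : ℝ} (hθ₀ : 0 < θ) (hθ : θ < Real.pi / (2 * k))
    {L : ℂ} (hL : |L.im| < Real.pi / k) :
    |L.im| < θ ↔ 0 < (Complex.exp (-(k * L))).re ∧
      |(Complex.exp (-(k * L))).im| < Real.tan (k * θ) * (Complex.exp (-(k * L))).re := by
  have hk' : (0 : ℝ) < k := by exact_mod_cast hk
  have him : (-(k * L)).im = -(k * L.im) := by simp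
  have h1 : |(-(k * L)).im| < Real.pi := by
    rw [him, abs_neg, abs_mul, abs_of_pos hk', mul_comm]; rwa [lt_div_iff₀ hk'] at hL
  have h2 : k * θ < Real.pi / 2 := by
    rw [lt_div_iff₀ (by positivity)] at hθ
    linarith
  rw [← abs_arg_lt_iff (Complex.exp_ne_zero _) (by positivity) h2, arg_exp_of_abs_im_lt h1, him,
    abs_neg, abs_mul, abs_of_pos hk', mul_lt_mul_iff_right₀ hk']

/-! ### Logarithmic estimates -/

lemma norm_log_one_sub_add_le {t : ℂ} (ht : ‖t‖ ≤ 1 / 2) : ‖Complex.log (1 - t) + t‖ ≤ ‖t‖ ^ 2 := by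
  have h := Complex.norm_log_one_add_sub_self_le (z := -t) (by rw [norm_neg]; linarith)
  rw [norm_neg, ← sub_eq_add_neg, sub_neg_eq_add] at h
  refine h.trans ?_
  have h1 : (1 - ‖t‖)⁻¹ ≤ 2 := by
    rw [inv_le_comm₀ (by linarith) (by norm_num)]; linarith
  nlinarith [sq_nonneg ‖t‖]

/-- The logarithm of the factor by which a step of the dynamics multiplies `z^1 ⋯ z^d`, in terms of
`y = (z^1 ⋯ z^d)^k` and the relative errors `ρ`. -/
def stepLog (d k : ℕ) (y : ℂ) (ρ : Fin d → ℂ) : ℂ :=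
  d * Complex.log (1 - y / (k * d)) + ∑ j, Complex.log (1 + ρ j)

lemma norm_div_nat_mul_nat_le {d k : ℕ} (hd : 1 ≤ d) (hk : 1 ≤ k) (y : ℂ) : ‖y / (k * d)‖ ≤ ‖y‖ := by
  rw [norm_div, norm_mul, Complex.norm_natCast, Complex.norm_natCast]
  have h1 : (1 : ℝ) ≤ k := by exact_mod_cast hk
  have h2 : (1 : ℝ) ≤ d := by exact_mod_cast hd
  exact div_le_self (norm_nonneg _) (by nlinarith)

/-- The `d` equal terms `-y/(kd)` add up to `-y/k`; everything else is quadratic in `y`. -/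
lemma norm_stepLog_add_le {d k : ℕ} (hd : 1 ≤ d) (hk : 1 ≤ k) {C : ℝ} {y : ℂ} {ρ : Fin d → ℂ}
    (hy : ‖y‖ ≤ 1 / 2) (hρ : ∀ j, ‖ρ j‖ ≤ 1 / 2) (hρC : ∀ j, ‖ρ j‖ ≤ C * ‖y‖ ^ 2) :
    ‖stepLog d k y ρ + y / k‖ ≤ d * (1 + 3 / 2 * C) * ‖y‖ ^ 2 := by
  have hd' : (d : ℂ) ≠ 0 := by exact_mod_cast (by omega : d ≠ 0)
  have hk' : (k : ℂ) ≠ 0 := by exact_mod_cast (by omega : k ≠ 0)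
  have h0 := norm_div_nat_mul_nat_le hd hk y
  have h1 := norm_log_one_sub_add_le (h0.trans hy)
  have h2 : stepLog d k y ρ + y / k =
      d * (Complex.log (1 - y / (k * d)) + y / (k * d)) + ∑ j, Complex.log (1 + ρ j) := by
    rw [stepLog]; field_simp; ring
  rw [h2]
  have h3 : ‖∑ j, Complex.log (1 + ρ j)‖ ≤ ∑ _j : Fin d, 3 / 2 * (C * ‖y‖ ^ 2) :=
    norm_sum_le_of_le _ fun j _ => (Complex.norm_log_one_add_half_le_self (hρ j)).trans (by
      have := hρC j; linarith)
  have h4 : ‖(d : ℂ) * (Complex.log (1 - y / (k * d)) + y / (k * d))‖ ≤ d * ‖y‖ ^ 2 := by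
    rw [norm_mul, Complex.norm_natCast]
    have : ‖y / (k * d)‖ ^ 2 ≤ ‖y‖ ^ 2 := by gcongr
    gcongr
    exact h1.trans this
  refine (norm_add_le _ _).trans ((add_le_add h4 h3).trans ?_)
  simp only [Finset.sum_const, Finset.card_univ, Fintype.card_fin, nsmul_eq_mul]
  exact le_of_eq (by ring)

/-- A step of the dynamics is close to the translation `Y ↦ Y + 1` in the coordinate `Y = 1 / y`. -/
lemma norm_inv_mul_exp_stepLog_le {k : ℕ} (hk : 1 ≤ k) {B : ℝ} (hB : 0 ≤ B) {y s : ℂ}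
    (hy0 : y ≠ 0) (hy1 : ‖y‖ ≤ 1) (hy : (1 + k * B) * ‖y‖ ≤ 1)
    (hs : ‖s + y / k‖ ≤ B * ‖y‖ ^ 2) :
    ‖y⁻¹ * Complex.exp (-(k * s)) - y⁻¹ - 1‖ ≤ ((1 + k * B) ^ 2 + k * B) * ‖y‖ := by
  have hk' : (k : ℂ) ≠ 0 := by exact_mod_cast (by omega : k ≠ 0)
  have hny : 0 < ‖y‖ := norm_pos_iff.2 hy0
  have he : ‖-(k * s) - y‖ ≤ k * B * ‖y‖ ^ 2 := by
    have : -(k * s) - y = -(k * (s + y / k)) := by field_simp; ring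
    rw [this, norm_neg, norm_mul, Complex.norm_natCast, mul_assoc]
    gcongr
  have hw : ‖-(k * s)‖ ≤ (1 + k * B) * ‖y‖ := by
    have h1 : -(k * s) = y + (-(k * s) - y) := by ring
    rw [h1]
    refine (norm_add_le _ _).trans ?_
    have : k * B * ‖y‖ ^ 2 ≤ k * B * ‖y‖ := by
      have : ‖y‖ ^ 2 ≤ ‖y‖ := by nlinarith
      gcongr
    linarith
  have hexp := Complex.norm_exp_sub_one_sub_id_le (hw.trans hy)
  -- With `w = -ks`, both the Taylor remainder `exp w - 1 - w` and the error `w - y` are `O(|y|^2)`,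
  -- and dividing by `y` leaves `O(|y|)`.
  have h2 : y⁻¹ * Complex.exp (-(k * s)) - y⁻¹ - 1
      = y⁻¹ * ((Complex.exp (-(k * s)) - 1 - -(k * s)) + (-(k * s) - y)) := by
    field_simp; ring
  rw [h2, norm_mul, norm_inv, inv_mul_le_iff₀ hny]
  refine (norm_add_le _ _).trans ((add_le_add hexp he).trans ?_)
  have : ‖-(k * s)‖ ^ 2 ≤ ((1 + k * B) * ‖y‖) ^ 2 := by gcongr
  nlinarith

/-! ### One step of the dynamics on the local basin -/

/-- The relative error of the `j`-th component of `F` with respect to its normal form. -/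
def relErr {d : ℕ} (lam : Fin d → ℂ) (k : ℕ)
    (F : EuclideanSpace ℂ (Fin d) → EuclideanSpace ℂ (Fin d)) (z : EuclideanSpace ℂ (Fin d))
    (j : Fin d) : ℂ :=
  F z j / (lam j * z j * (1 - coordProd z ^ k / (k * d))) - 1

lemma coordProd_ne_zero_iff {d : ℕ} {z : EuclideanSpace ℂ (Fin d)} :
    coordProd z ≠ 0 ↔ ∀ j, z j ≠ 0 := by
  simp [coordProd, Finset.prod_ne_zero_iff]

lemma EuclideanSpace.norm_le_card_mul {d : ℕ} {z : EuclideanSpace ℂ (Fin d)} {M : ℝ} (hM : 0 ≤ M)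
    (hz : ∀ j, ‖z j‖ ≤ M) : ‖z‖ ≤ d * M := by
  have h1 : ‖z‖ ^ 2 ≤ (d * M) ^ 2 := by
    rw [EuclideanSpace.norm_sq_eq]
    calc ∑ j, ‖z j‖ ^ 2 ≤ ∑ _j : Fin d, M ^ 2 := by
          gcongr with j; exact hz j
      _ = d * M ^ 2 := by simp
      _ ≤ (d * M) ^ 2 := by
          have : (d : ℝ) ≤ (d : ℝ) ^ 2 := by
            exact_mod_cast Nat.le_self_pow (by norm_num) d
          rw [mul_pow]; gcongr
  exact (sq_le_sq₀ (norm_nonneg _) (by positivity)).1 h1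

/-- In the region `‖z j‖ < ‖u‖ ^ β`, no coordinate is much smaller than the others. -/
lemma norm_coordProd_le_mul {d : ℕ} {β : ℝ} {z : EuclideanSpace ℂ (Fin d)}
    (hz : z ∈ modulusRegion d β) (j : Fin d) :
    ‖coordProd z‖ ≤ ‖z j‖ * ‖coordProd z‖ ^ (β * ((d : ℝ) - 1)) := by
  have hd : 1 ≤ d := by have := j.pos; omega
  have h1 : ‖coordProd z‖ = ‖z j‖ * ∏ i ∈ Finset.univ.erase j, ‖z i‖ := by
    rw [coordProd, norm_prod]
    exact (Finset.mul_prod_erase _ (fun i => ‖z i‖) (Finset.mem_univ j)).symm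
  have h2 : ∏ i ∈ Finset.univ.erase j, ‖z i‖ ≤ (‖coordProd z‖ ^ β) ^ (d - 1) := by
    refine (Finset.prod_le_prod (fun _ _ => norm_nonneg _) fun i _ => (hz i).le).trans ?_
    simp [Finset.card_erase_of_mem]
  have h3 : (‖coordProd z‖ ^ β) ^ (d - 1) = ‖coordProd z‖ ^ (β * ((d : ℝ) - 1)) := by
    rw [← Real.rpow_natCast, ← Real.rpow_mul (norm_nonneg _), Nat.cast_sub hd, Nat.cast_one]
  rw [h3] at h2
  calc ‖coordProd z‖ = _ := h1
    _ ≤ _ := by gcongr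

lemma eventually_mul_lt {b : ℝ} (a : ℝ) (hb : 0 < b) : ∀ᶠ r in 𝓝[>] (0 : ℝ), a * r < b := by
  have : Tendsto (fun r : ℝ => a * r) (𝓝[>] 0) (𝓝 0) := by
    have h : Continuous fun r : ℝ => a * r := by fun_prop
    simpa using h.tendsto' 0 0 (by simp) |>.mono_left nhdsWithin_le_nhds
  exact this.eventually_lt_const hb

lemma eventually_mul_rpow_lt {b β : ℝ} (a : ℝ) (hβ : 0 < β) (hb : 0 < b) :
    ∀ᶠ r in 𝓝[>] (0 : ℝ), a * r ^ β < b := by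
  have h : Tendsto (fun r : ℝ => a * r ^ β) (𝓝[>] 0) (𝓝 0) := by
    have h : ContinuousAt (fun r : ℝ => a * r ^ β) 0 :=
      continuousAt_const.mul (Real.continuousAt_rpow_const 0 β (Or.inr hβ.le))
    simpa [ContinuousAt, Real.zero_rpow hβ.ne'] using h.mono_left nhdsWithin_le_nhds
  exact h.eventually_lt_const hb

lemma half_le_norm_one_sub {t : ℂ} (ht : ‖t‖ ≤ 1 / 2) : 1 / 2 ≤ ‖1 - t‖ := by
  have := norm_sub_norm_le (1 : ℂ) t
  rw [norm_one] at this
  linarith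

/-- The absolute error is `O(|u|^(βl))`, while `|z j| ≥ |u|^(1 - β(d-1))`. The relative error is
thus `O(|u|^(β(l+d-1) - 1))`, and the hypothesis on `β` bounds this by `|u|^(2k) = |y|^2`, which is
what makes the errors summable along orbits. -/
lemma exists_relErr_bound {d k l : ℕ} (hk : 1 ≤ k) {lam : Fin d → ℂ} (hlam : ∀ j, ‖lam j‖ = 1)
    {U : Set (EuclideanSpace ℂ (Fin d))} (hU : U ∈ 𝓝 0)
    {F : EuclideanSpace ℂ (Fin d) → EuclideanSpace ℂ (Fin d)}
    (hFN : (fun z => F z - normalForm lam k z) =O[𝓝 0] (fun z => ‖z‖ ^ l))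
    {β : ℝ} (hβ : 0 < β) (hβl : 2 * (k : ℝ) + 1 < β * ((l : ℝ) + d - 1)) :
    ∃ C, 0 ≤ C ∧ ∃ r, 0 < r ∧ ∀ z ∈ modulusRegion d β, coordProd z ≠ 0 → ‖coordProd z‖ ≤ r →
      z ∈ U ∧ ∀ j, ‖relErr lam k F z j‖ ≤ C * ‖coordProd z ^ k‖ ^ 2 := by
  obtain ⟨c, hc, hbd⟩ := hFN.exists_nonneg
  obtain ⟨ε, hε, hball⟩ := Metric.eventually_nhds_iff.1 (hbd.bound.and hU)
  obtain ⟨r, ⟨hrε, hr1⟩, hr0⟩ := ((eventually_mul_rpow_lt d hβ hε).and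
    (eventually_mul_lt 2 one_pos)).and self_mem_nhdsWithin |>.exists
  have hr0 : 0 < r := hr0
  -- Here `c` is the constant of the `O`-term, `d ^ l` comes from `‖z‖ ≤ d |u|^β`, and `2` from `|1
  -- - y/(kd)| ≥ 1/2`.
  refine ⟨c * d ^ l * 2, by positivity, r, hr0, fun z hz hu0 hur => ?_⟩
  set u := coordProd z with hu
  have hun : 0 < ‖u‖ := norm_pos_iff.2 hu0
  have hu1 : ‖u‖ ≤ 1 / 2 := by linarith
  have hzn : ‖z‖ ≤ d * ‖u‖ ^ β :=
    EuclideanSpace.norm_le_card_mul (by positivity) fun j => (hz j).le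
  have hzε : dist z 0 < ε := by
    rw [dist_zero_right]
    refine hzn.trans_lt (lt_of_le_of_lt ?_ hrε)
    gcongr
  obtain ⟨hFz, hzU⟩ := hball hzε
  refine ⟨hzU, fun j => ?_⟩
  have hd : 1 ≤ d := by have := j.pos; omega
  have hzj : z j ≠ 0 := coordProd_ne_zero_iff.1 hu0 j
  have hlj : lam j ≠ 0 := fun h => by simpa [h] using hlam j
  have hyn : ‖u ^ k‖ ≤ 1 / 2 := by
    rw [norm_pow]
    exact (pow_le_of_le_one (norm_nonneg _) (by linarith) (by omega)).trans hu1
  have hA : 1 / 2 ≤ ‖1 - u ^ k / (k * d)‖ :=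
    half_le_norm_one_sub ((norm_div_nat_mul_nat_le hd hk _).trans hyn)
  have hA0 : 1 - u ^ k / (k * d) ≠ 0 := norm_pos_iff.1 (by linarith)
  have h1 : relErr lam k F z j = (F z - normalForm lam k z) j /
      (lam j * z j * (1 - u ^ k / (k * d))) := by
    rw [relErr, PiLp.sub_apply, sub_div, ← hu]
    congr 1
    simp only [normalForm, ← hu]
    rw [div_self (by simp [hlj, hzj, hA0])]
  have h2 : ‖(F z - normalForm lam k z) j‖ ≤ c * (d * ‖u‖ ^ β) ^ l := by
    refine (PiLp.norm_apply_le _ j).trans (hFz.trans ?_)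
    rw [Real.norm_of_nonneg (by positivity)]
    gcongr
  have h3 := norm_coordProd_le_mul hz j
  rw [← hu] at h3
  have h4 : (‖u‖ ^ β) ^ l * ‖u‖ ^ (β * ((d : ℝ) - 1)) ≤ ‖u ^ k‖ ^ 2 * ‖u‖ := by
    have e1 : (‖u‖ ^ β) ^ l * ‖u‖ ^ (β * ((d : ℝ) - 1)) = ‖u‖ ^ (β * ((l : ℝ) + d - 1)) := by
      rw [← Real.rpow_natCast, ← Real.rpow_mul hun.le, ← Real.rpow_add hun]
      congr 1; ring
    have e2 : ‖u ^ k‖ ^ 2 * ‖u‖ = ‖u‖ ^ (2 * (k : ℝ) + 1) := by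
      rw [norm_pow, ← pow_mul, ← pow_succ, ← Real.rpow_natCast]
      congr 1; push_cast; ring
    rw [e1, e2]
    exact Real.rpow_le_rpow_of_exponent_ge hun (by linarith) hβl.le
  have hznj : 0 < ‖z j‖ := norm_pos_iff.2 hzj
  rw [h1, norm_div, norm_mul, norm_mul, hlam, one_mul, div_le_iff₀ (by positivity)]
  refine h2.trans ?_
  have h5 : (‖u‖ ^ β) ^ l ≤ ‖u ^ k‖ ^ 2 * ‖z j‖ := by
    have hp : 0 < ‖u‖ ^ (β * ((d : ℝ) - 1)) := Real.rpow_pos_of_pos hun _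
    refine le_of_mul_le_mul_right (h4.trans ?_) hp
    rw [mul_assoc]; gcongr
  calc c * (d * ‖u‖ ^ β) ^ l = c * d ^ l * (‖u‖ ^ β) ^ l := by rw [mul_pow]; ring
    _ ≤ c * d ^ l * (‖u ^ k‖ ^ 2 * ‖z j‖) := by gcongr
    _ = c * d ^ l * 2 * ‖u ^ k‖ ^ 2 * (‖z j‖ * (1 / 2)) := by ring
    _ ≤ _ := by gcongr

/-- The moduli stay in the region `‖z j‖ < ‖u‖ ^ β` after a step. -/
lemma re_log_add_re_log_le {d k : ℕ} (hd : 1 ≤ d) (hk : 1 ≤ k) {C κ β : ℝ}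
    (hβ : 0 < β) (hβd : d * β < 1) {y : ℂ} {ρ : Fin d → ℂ}
    (hy : ‖y‖ ≤ 1 / 2) (hρ : ∀ j, ‖ρ j‖ ≤ 1 / 2) (hρC : ∀ j, ‖ρ j‖ ≤ C * ‖y‖ ^ 2)
    (hκ : κ * ‖y‖ ≤ y.re)
    (hsmall : ((1 - d * β) + (1 + d * β) * (3 / 2 * C)) * ‖y‖ ≤ (1 - d * β) * κ / (k * d))
    (j : Fin d) :
    (Complex.log (1 - y / (k * d)) + Complex.log (1 + ρ j)).re ≤ β * (stepLog d k y ρ).re := by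
  have hd' : (0 : ℝ) < d := by exact_mod_cast hd
  have hk' : (0 : ℝ) < k := by exact_mod_cast hk
  have h0 := norm_div_nat_mul_nat_le hd hk y
  have h1 := (Complex.re_le_norm _).trans (norm_log_one_sub_add_le (h0.trans hy))
  have hsq : ‖y / (k * d)‖ ^ 2 ≤ ‖y‖ ^ 2 := by gcongr
  have hre : (y / (k * d)).re = y.re / (k * d) := by
    rw [show (k : ℂ) * d = ((k * d : ℝ) : ℂ) by push_cast; rfl, Complex.div_ofReal_re]
  rw [Complex.add_re, hre] at h1
  have hρ' : ∀ i, |(Complex.log (1 + ρ i)).re| ≤ 3 / 2 * C * ‖y‖ ^ 2 := fun i =>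
    (Complex.abs_re_le_norm _).trans ((Complex.norm_log_one_add_half_le_self (hρ i)).trans
      (by have := hρC i; linarith))
  have hsum : -(d * (3 / 2 * C * ‖y‖ ^ 2)) ≤ ∑ i, (Complex.log (1 + ρ i)).re := by
    have : ∑ _i : Fin d, -(3 / 2 * C * ‖y‖ ^ 2) ≤ ∑ i, (Complex.log (1 + ρ i)).re :=
      Finset.sum_le_sum fun i _ => (abs_le.1 (hρ' i)).1
    simpa using this
  have hj := (abs_le.1 (hρ' j)).2
  have hs : (stepLog d k y ρ).re =
      d * (Complex.log (1 - y / (k * d))).re + ∑ i, (Complex.log (1 + ρ i)).re := by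
    simp [stepLog, Complex.re_sum]
  rw [hs, Complex.add_re]
  have h2 : κ * ‖y‖ / (k * d) ≤ y.re / (k * d) := by gcongr
  have h3 := mul_le_mul_of_nonneg_right hsmall (norm_nonneg y)
  have h4 : (1 - d * β) * κ / (k * d) * ‖y‖ = (1 - d * β) * (κ * ‖y‖ / (k * d)) := by ring
  rw [h4] at h3
  -- In `log |z j| - β log |u|` the common factor enters with weight `1 - dβ > 0`. Its logarithm has
  -- real part at most `-κ|y|/(kd) + |y|^2`, and `hsmall` lets the negative linear term beat all the
  -- quadratic ones.
  have h5 : (1 - d * β) * (Complex.log (1 - y / (k * d))).re ≤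
      (1 - d * β) * (‖y‖ ^ 2 - κ * ‖y‖ / (k * d)) := by
    apply mul_le_mul_of_nonneg_left _ (by linarith)
    linarith
  have h6 := mul_le_mul_of_nonneg_left hsum hβ.le
  nlinarith

/-- The data controlling one step of the dynamics at a point `z` of the `h`-th local basin. -/
structure StepEstimate {d : ℕ} (lam : Fin d → ℂ) (k h : ℕ) (θ β K : ℝ)
    (U : Set (EuclideanSpace ℂ (Fin d)))
    (F : EuclideanSpace ℂ (Fin d) → EuclideanSpace ℂ (Fin d)) (z : EuclideanSpace ℂ (Fin d)) :
    Prop where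
  mem : z ∈ U
  norm_pow_le : ‖coordProd z ^ k‖ ≤ 1 / 2
  relErr_le_half : ∀ j, ‖relErr lam k F z j‖ ≤ 1 / 2
  relErr_le : ∀ j, ‖relErr lam k F z j‖ ≤ K * ‖coordProd z ^ k‖ ^ 2
  apply_eq : ∀ j, F z j = lam j * z j *
    Complex.exp (Complex.log (1 - coordProd z ^ k / (k * d)) + Complex.log (1 + relErr lam k F z j))
  modulus : F z ∈ modulusRegion d β
  sectorLog_eq : sectorLog k h (coordProd (F z)) =
    sectorLog k h (coordProd z) + stepLog d k (coordProd z ^ k) (relErr lam k F z)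
  coordProd_eq : coordProd (F z) =
    coordProd z * Complex.exp (stepLog d k (coordProd z ^ k) (relErr lam k F z))
  abs_im_lt : |(sectorLog k h (coordProd (F z))).im| < θ
  inv_sub_le : ‖(coordProd (F z) ^ k)⁻¹ - (coordProd z ^ k)⁻¹ - 1‖ ≤ K * ‖coordProd z ^ k‖
  inv_sub_le_half : ‖(coordProd (F z) ^ k)⁻¹ - (coordProd z ^ k)⁻¹ - 1‖ ≤ 1 / 2

lemma ne_zero_of_norm_le_half {w : ℂ} (hw : ‖w‖ ≤ 1 / 2) : 1 + w ≠ 0 := by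
  have := half_le_norm_one_sub (t := -w) (by rwa [norm_neg])
  rw [sub_neg_eq_add] at this
  exact norm_pos_iff.1 (by linarith)

lemma apply_eq_mul_exp {d k : ℕ} (hd : 1 ≤ d) (hk : 1 ≤ k) {lam : Fin d → ℂ}
    (hlam : ∀ j, ‖lam j‖ = 1)
    {F : EuclideanSpace ℂ (Fin d) → EuclideanSpace ℂ (Fin d)} {z : EuclideanSpace ℂ (Fin d)}
    (hz : coordProd z ≠ 0) (hy : ‖coordProd z ^ k‖ ≤ 1 / 2) {j : Fin d}
    (hρ : ‖relErr lam k F z j‖ ≤ 1 / 2) :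
    F z j = lam j * z j * Complex.exp
      (Complex.log (1 - coordProd z ^ k / (k * d)) + Complex.log (1 + relErr lam k F z j)) := by
  have hA := half_le_norm_one_sub ((norm_div_nat_mul_nat_le hd hk _).trans hy)
  have hA0 : 1 - coordProd z ^ k / (k * d) ≠ 0 := norm_pos_iff.1 (by linarith)
  have hlj : lam j ≠ 0 := fun h => by simpa [h] using hlam j
  have hzj := coordProd_ne_zero_iff.1 hz j
  rw [Complex.exp_add, Complex.exp_log hA0, Complex.exp_log (ne_zero_of_norm_le_half hρ), relErr,
    add_sub_cancel, ← mul_assoc, mul_div_cancel₀]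
  exact mul_ne_zero (mul_ne_zero hlj hzj) hA0

lemma coordProd_eq_mul_exp {d k : ℕ} {lam : Fin d → ℂ} (hprod : ∏ j, lam j = 1)
    {z w : EuclideanSpace ℂ (Fin d)} {y : ℂ} {ρ : Fin d → ℂ}
    (h : ∀ j, w j = lam j * z j *
      Complex.exp (Complex.log (1 - y / (k * d)) + Complex.log (1 + ρ j))) :
    coordProd w = coordProd z * Complex.exp (stepLog d k y ρ) := by
  simp only [coordProd, h, Finset.prod_mul_distrib, hprod, one_mul, ← Complex.exp_sum,
    Finset.sum_add_distrib, stepLog]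
  simp

lemma cos_mul_norm_le_re {k h : ℕ} (hk : 1 ≤ k) {θ : ℝ} (hθ : θ < Real.pi / (2 * k)) {u : ℂ}
    (hu : u ≠ 0) (hL : |(sectorLog k h u).im| < θ) :
    Real.cos (k * θ) * ‖u ^ k‖ ≤ (u ^ k).re := by
  have hk' : (0 : ℝ) < k := by exact_mod_cast hk
  have hkθ : k * θ < Real.pi / 2 := by
    rw [lt_div_iff₀ (by positivity)] at hθ
    linarith
  have h1 : u ^ k = Complex.exp (k * sectorLog k h u) := by
    rw [← inv_inv (u ^ k), ← exp_neg_mul_sectorLog hk h hu, ← Complex.exp_neg, neg_neg]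
  rw [h1, Complex.norm_exp, Complex.exp_re, mul_comm]
  have h2 : ((k : ℂ) * sectorLog k h u).im = k * (sectorLog k h u).im := by simp
  rw [h2, ← Real.cos_abs (k * (sectorLog k h u).im), abs_mul, abs_of_pos hk']
  gcongr
  exact Real.cos_le_cos_of_nonneg_of_le_pi (by positivity) (by linarith [Real.pi_pos])
    (by gcongr)

/-- Translation by `1` moves a cone about the positive axis into itself with a margin, and `hεT`
says that the error `ε` fits in this margin. The a priori bound on `L'.im` is needed because `exp
(-k L')` determines it only modulo `2π/k`. -/
lemma abs_im_lt_of_norm_sub_le {k : ℕ} (hk : 1 ≤ k) {θ ε : ℝ} (hθ₀ : 0 < θ)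
    (hθ : θ < Real.pi / (2 * k)) {L L' : ℂ} (hL : |L.im| < θ) (hL' : |L'.im| < Real.pi / k)
    (h : ‖Complex.exp (-(k * L')) - Complex.exp (-(k * L)) - 1‖ ≤ ε) (hε : ε < 1)
    (hεT : (1 + Real.tan (k * θ)) * ε ≤ Real.tan (k * θ)) : |L'.im| < θ := by
  have hk' : (0 : ℝ) < k := by exact_mod_cast hk
  have hLk : |L.im| < Real.pi / k := by
    refine (hL.trans hθ).trans_le ?_
    gcongr
    linarith
  obtain ⟨hc1, hc2⟩ := (abs_im_lt_iff_cone hk hθ₀ hθ hLk).1 hL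
  rw [abs_im_lt_iff_cone hk hθ₀ hθ hL']
  have hT : 0 < Real.tan (k * θ) := pos_of_mul_pos_left ((abs_nonneg _).trans_lt hc2) hc1.le
  generalize Complex.exp (-(k * L)) = Y at *
  generalize Complex.exp (-(k * L')) = Y' at *
  have hre' := (abs_le.1 ((Complex.abs_re_le_norm _).trans h)).1
  have him' := (Complex.abs_im_le_norm _).trans h
  simp only [Complex.sub_re, Complex.sub_im, Complex.one_re, Complex.one_im, sub_zero] at hre' him'
  have g3 : |Y'.im| ≤ |Y.im| + ε := by
    have := abs_add_le Y.im (Y'.im - Y.im)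
    rw [add_sub_cancel] at this
    linarith
  refine ⟨by linarith, ?_⟩
  have g4 : Real.tan (k * θ) * (Y.re + 1 - ε) ≤ Real.tan (k * θ) * Y'.re := by gcongr; linarith
  nlinarith

set_option maxHeartbeats 1000000 in
lemma exists_stepEstimate {d k l : ℕ} (hd : 1 ≤ d) (hk : 1 ≤ k) {lam : Fin d → ℂ}
    (hlam : ∀ j, ‖lam j‖ = 1) (hprod : ∏ j, lam j = 1)
    {U : Set (EuclideanSpace ℂ (Fin d))} (hU : U ∈ 𝓝 0)
    {F : EuclideanSpace ℂ (Fin d) → EuclideanSpace ℂ (Fin d)}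
    (hFN : (fun z => F z - normalForm lam k z) =O[𝓝 0] (fun z => ‖z‖ ^ l))
    {β : ℝ} (hβ : 0 < β) (hβd : β < 1 / d) (hβl : 2 * (k : ℝ) + 1 < β * ((l : ℝ) + d - 1))
    {θ : ℝ} (hθ₀ : 0 < θ) (hθ : θ < Real.pi / (2 * k)) :
    ∃ K, 0 ≤ K ∧ ∃ R₁, 1 ≤ R₁ ∧ ∀ h, ∀ z ∈ localBasin d k h R₁ θ β,
      StepEstimate lam k h θ β K U F z := by
  have hd' : (0 : ℝ) < d := by exact_mod_cast hd
  have hk' : (0 : ℝ) < k := by exact_mod_cast hk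
  have hkθ : k * θ < Real.pi / 2 := by
    have := hθ
    rw [lt_div_iff₀ (by positivity)] at this
    linarith
  have hβd' : d * β < 1 := by rwa [lt_div_iff₀ hd', mul_comm] at hβd
  have hT : 0 < Real.tan (k * θ) := Real.tan_pos_of_pos_of_lt_pi_div_two (by positivity) hkθ
  have hκ : 0 < Real.cos (k * θ) :=
    Real.cos_pos_of_mem_Ioo ⟨by linarith [Real.pi_pos, mul_pos hk' hθ₀], hkθ⟩
  set T := Real.tan (k * θ)
  set κ := Real.cos (k * θ)
  obtain ⟨C, hC, r₀, hr₀, hrel⟩ := exists_relErr_bound hk hlam hU hFN hβ hβl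
  set B : ℝ := d * (1 + 3 / 2 * C) with hB_def
  have hB : 0 ≤ B := by positivity
  set K₀ : ℝ := (1 + k * B) ^ 2 + k * B with hK₀_def
  have hK₀ : 0 ≤ K₀ := by positivity
  have hm : 0 < (1 - d * β) * κ / (k * d) :=
    div_pos (mul_pos (by linarith) hκ) (by positivity)
  -- The bounds on `r = 1 / R₁` ensure, in order: `|u| ≤ r₀`; `|y| ≤ 1/2`; `|ρ j| ≤ 1/2`; the
  -- estimate of `1/y`; a step too short to leave the branch `|Im| < π/k`; an error at most `1/2` in
  -- the translation; invariance of the cone; invariance of the moduli condition.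
  obtain ⟨r, ⟨⟨⟨⟨⟨⟨⟨⟨h1, h2⟩, h3⟩, h4⟩, h5⟩, h6⟩, h7⟩, h8⟩, hr⟩⟩ :=
    ((((((((eventually_mul_lt 1 (pow_pos hr₀ k)).and
    (eventually_mul_lt 2 one_pos)).and
    (eventually_mul_lt (2 * C) one_pos)).and
    (eventually_mul_lt (1 + k * B) one_pos)).and
    (eventually_mul_lt (1 + B) (b := Real.pi / (2 * k)) (by positivity))).and
    (eventually_mul_lt K₀ (b := 1 / 2) (by norm_num))).and
    (eventually_mul_lt (K₀ * (1 + T)) hT)).and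
    (eventually_mul_lt ((1 - d * β) + (1 + d * β) * (3 / 2 * C)) hm)).and
    self_mem_nhdsWithin |>.exists
  have hr : 0 < r := hr
  refine ⟨max C K₀, le_max_of_le_left hC, 1 / r, by rw [le_div_iff₀ hr]; linarith,
    fun h z hz => ?_⟩
  obtain ⟨hmod, hsec⟩ := hz
  obtain ⟨hu0, hre, hLθ⟩ := (mem_attractingSector_iff hk (by positivity)).1 hsec
  set u := coordProd z with hu
  set y := u ^ k with hy
  set ρ := relErr lam k F z with hρ_def
  have hy0 : y ≠ 0 := pow_ne_zero _ hu0
  have hyr : ‖y‖ ≤ r := by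
    have := hre.le.trans (Complex.re_le_norm _)
    rwa [norm_inv, one_div, inv_le_inv₀ hr (norm_pos_iff.2 hy0)] at this
  have hny : 0 ≤ ‖y‖ := norm_nonneg y
  have hur : ‖u‖ ≤ r₀ := by
    have : ‖u‖ ^ k ≤ r₀ ^ k := by rw [← norm_pow]; linarith
    exact (pow_le_pow_iff_left₀ (norm_nonneg _) hr₀.le (by omega)).1 this
  have hmul : ∀ {a b : ℝ}, 0 ≤ a → a * r < b → a * ‖y‖ < b := fun ha hab =>
    lt_of_le_of_lt (mul_le_mul_of_nonneg_left hyr ha) hab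
  obtain ⟨hzU, hρC⟩ := hrel z hmod hu0 hur
  have hyh : ‖y‖ ≤ 1 / 2 := by linarith
  have hρh : ∀ j, ‖ρ j‖ ≤ 1 / 2 := by
    intro j
    refine (hρC j).trans ?_
    have := hmul (by positivity) h3
    change C * ‖y‖ ^ 2 ≤ 1 / 2
    nlinarith
  have happ : ∀ j, F z j = lam j * z j * Complex.exp
      (Complex.log (1 - y / (k * d)) + Complex.log (1 + ρ j)) := fun j =>
    apply_eq_mul_exp hd hk hlam hu0 hyh (hρh j)
  have hprodF : coordProd (F z) = u * Complex.exp (stepLog d k y ρ) :=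
    coordProd_eq_mul_exp hprod happ
  set s := stepLog d k y ρ with hs_def
  have hs : ‖s + y / k‖ ≤ B * ‖y‖ ^ 2 := norm_stepLog_add_le hd hk hyh hρh hρC
  have hsn : ‖s‖ < Real.pi / (2 * k) := by
    have e1 : ‖y / k‖ ≤ ‖y‖ := by
      rw [norm_div, Complex.norm_natCast]
      exact div_le_self hny (by exact_mod_cast hk)
    have e2 : ‖s‖ ≤ ‖s + y / k‖ + ‖y / k‖ := by
      simpa using norm_sub_le (s + y / k) (y / k)
    have e3 := hmul (by positivity) h5
    have e4 : B * ‖y‖ ^ 2 ≤ B * ‖y‖ := by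
      have : ‖y‖ ^ 2 ≤ ‖y‖ := by nlinarith
      gcongr
    linarith
  have hLk : |(sectorLog k h u + s).im| < Real.pi / k := by
    rw [Complex.add_im]
    have e1 := abs_add_le (sectorLog k h u).im s.im
    have e2 := Complex.abs_im_le_norm s
    have e3 : Real.pi / k = Real.pi / (2 * k) + Real.pi / (2 * k) := by field_simp; ring
    rw [e3]; linarith
  have hk1 : Real.pi / k ≤ Real.pi := div_le_self Real.pi_pos.le (by exact_mod_cast hk)
  have hlog : sectorLog k h (coordProd (F z)) = sectorLog k h u + s := by
    rw [hprodF, sectorLog_mul_exp k h hu0 (hLk.trans_le hk1)]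
  have hexp : Complex.exp (-(k * (sectorLog k h u + s))) = y⁻¹ * Complex.exp (-(k * s)) := by
    rw [hy, ← exp_neg_mul_sectorLog hk h hu0, ← Complex.exp_add]; ring_nf
  have hYF : (coordProd (F z) ^ k)⁻¹ = y⁻¹ * Complex.exp (-(k * s)) := by
    have : coordProd (F z) ≠ 0 := by
      rw [hprodF]; exact mul_ne_zero hu0 (Complex.exp_ne_zero _)
    rw [← exp_neg_mul_sectorLog hk h this, hlog, hexp]
  have hinv : ‖y⁻¹ * Complex.exp (-(k * s)) - y⁻¹ - 1‖ ≤ K₀ * ‖y‖ :=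
    norm_inv_mul_exp_stepLog_le hk hB hy0 (by linarith) (hmul (by positivity) h4).le hs
  refine ⟨hzU, hyh, hρh, fun j => (hρC j).trans ?_, happ, fun j => ?_, hlog, hprodF, ?_, ?_, ?_⟩
  · gcongr; exact le_max_left _ _
  · have hm' : 0 ≤ (1 - d * β) + (1 + d * β) * (3 / 2 * C) := by
      have : 0 ≤ (1 + d * β) * (3 / 2 * C) := by positivity
      linarith
    have hj := re_log_add_re_log_le hd hk hβ hβd' hyh hρh hρC
      (cos_mul_norm_le_re hk hθ hu0 hLθ) (hmul hm' h8).le j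
    rw [happ, hprodF, norm_mul, norm_mul, hlam, one_mul, Complex.norm_exp, norm_mul,
      Complex.norm_exp, Real.mul_rpow (norm_nonneg _) (Real.exp_pos _).le, ← Real.exp_mul,
      mul_comm _ β]
    exact mul_lt_mul (hmod j) (Real.exp_le_exp.2 hj) (Real.exp_pos _)
      (Real.rpow_nonneg (norm_nonneg _) _)
  · rw [hlog]
    refine abs_im_lt_of_norm_sub_le hk hθ₀ hθ hLθ hLk (ε := K₀ * ‖y‖) ?_
      ((hmul hK₀ h6).trans (by norm_num)) ?_
    · rw [hexp, exp_neg_mul_sectorLog hk h hu0]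
      exact hinv
    · have g2 := hmul (by positivity) h7
      linarith
  · rw [hYF]
    exact hinv.trans (by gcongr; exact le_max_right _ _)
  · rw [hYF]
    exact hinv.trans (hmul (by positivity) h6).le

/-! ### Orbits in the local basins -/

section Basin

variable {d k h : ℕ} {θ β : ℝ}

lemma localBasin_subset (hk : 1 ≤ k) {R R' : ℝ} (hR : 0 < R) (hRR' : R ≤ R') :
    localBasin d k h R' θ β ⊆ localBasin d k h R θ β := by
  rintro z ⟨hm, hs⟩
  obtain ⟨h0, h1, h2⟩ := (mem_attractingSector_iff hk (hR.trans_le hRR')).1 hs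
  exact ⟨hm, (mem_attractingSector_iff hk hR).2 ⟨h0, hRR'.trans_lt h1, h2⟩⟩

lemma coordProd_ne_zero_of_mem (hk : 1 ≤ k) {R : ℝ} (hR : 0 < R) {z : EuclideanSpace ℂ (Fin d)}
    (hz : z ∈ localBasin d k h R θ β) : coordProd z ≠ 0 :=
  ((mem_attractingSector_iff hk hR).1 hz.2).1

lemma norm_coordProd_pow_le (hk : 1 ≤ k) {R : ℝ} (hR : 0 < R) {z : EuclideanSpace ℂ (Fin d)}
    (hz : z ∈ localBasin d k h R θ β) : ‖coordProd z ^ k‖ ≤ 1 / R := by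
  obtain ⟨h0, h1, -⟩ := (mem_attractingSector_iff hk hR).1 hz.2
  have h2 := h1.le.trans (Complex.re_le_norm _)
  rw [norm_inv] at h2
  rwa [one_div, le_inv_comm₀ (norm_pos_iff.2 (pow_ne_zero _ h0)) hR]

lemma norm_le_of_mem_localBasin (hk : 1 ≤ k) (hβ : 0 < β) {R : ℝ} (hR : 0 < R)
    {z : EuclideanSpace ℂ (Fin d)} (hz : z ∈ localBasin d k h R θ β) :
    ‖z‖ ≤ d * (1 / R) ^ (β / k) := by
  have hk' : (k : ℝ) ≠ 0 := by exact_mod_cast (by omega : k ≠ 0)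
  refine EuclideanSpace.norm_le_card_mul (by positivity) fun j => (hz.1 j).le.trans ?_
  have h1 : ‖coordProd z‖ ^ β = ‖coordProd z ^ k‖ ^ (β / k) := by
    rw [norm_pow, ← Real.rpow_natCast, ← Real.rpow_mul (norm_nonneg _)]
    congr 1
    field_simp
  rw [h1]
  exact Real.rpow_le_rpow (norm_nonneg _) (norm_coordProd_pow_le hk hR hz) (by positivity)

variable {lam : Fin d → ℂ} {K R₁ : ℝ} {U : Set (EuclideanSpace ℂ (Fin d))}
  {F : EuclideanSpace ℂ (Fin d) → EuclideanSpace ℂ (Fin d)}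

/-- The translation by `1` has error at most `1/2`, so the real part of `1/y` grows by at least
`1/2`. -/
lemma apply_mem_localBasin (hk : 1 ≤ k) (hR₁ : 1 ≤ R₁)
    (hstep : ∀ z ∈ localBasin d k h R₁ θ β, StepEstimate lam k h θ β K U F z)
    {R : ℝ} (hR : R₁ ≤ R) {z : EuclideanSpace ℂ (Fin d)} (hz : z ∈ localBasin d k h R θ β) :
    F z ∈ localBasin d k h (R + 1 / 2) θ β := by
  have hR0 : 0 < R := by linarith
  have hs := hstep z (localBasin_subset hk (by linarith) hR hz)
  obtain ⟨h0, h1, -⟩ := (mem_attractingSector_iff hk hR0).1 hz.2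
  refine ⟨hs.modulus, (mem_attractingSector_iff hk (by linarith)).2 ⟨?_, ?_, hs.abs_im_lt⟩⟩
  · rw [hs.coordProd_eq]
    exact mul_ne_zero h0 (Complex.exp_ne_zero _)
  · have := (abs_le.1 ((Complex.abs_re_le_norm _).trans hs.inv_sub_le_half)).1
    simp only [Complex.sub_re, Complex.one_re] at this
    linarith

lemma iterate_mem_localBasin (hk : 1 ≤ k) (hR₁ : 1 ≤ R₁)
    (hstep : ∀ z ∈ localBasin d k h R₁ θ β, StepEstimate lam k h θ β K U F z)
    {R : ℝ} (hR : R₁ ≤ R) {z : EuclideanSpace ℂ (Fin d)} (hz : z ∈ localBasin d k h R θ β)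
    (n : ℕ) : F^[n] z ∈ localBasin d k h (R + n / 2) θ β := by
  induction n with
  | zero => simpa using hz
  | succ n ih =>
    rw [Function.iterate_succ_apply']
    have hn : (0 : ℝ) ≤ n := Nat.cast_nonneg n
    have := apply_mem_localBasin hk hR₁ hstep (by linarith) ih
    rwa [add_assoc, ← add_div, ← Nat.cast_add_one] at this

lemma isUniformLocalBasin_localBasin (hk : 1 ≤ k) (hβ : 0 < β) (hR₁ : 1 ≤ R₁)
    (hstep : ∀ z ∈ localBasin d k h R₁ θ β, StepEstimate lam k h θ β K U F z) :
    IsUniformLocalBasin F U (localBasin d k h R₁ θ β) := by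
  have hk' : (0 : ℝ) < k := by exact_mod_cast hk
  refine ⟨fun z hz => (hstep z hz).mem, fun z hz =>
    localBasin_subset hk (by linarith) (by linarith) (apply_mem_localBasin hk hR₁ hstep le_rfl hz),
    ?_⟩
  have hlim : Tendsto (fun n : ℕ => d * (1 / (R₁ + n / 2)) ^ (β / k)) atTop (𝓝 0) := by
    have h1 : Tendsto (fun n : ℕ => R₁ + (n : ℝ) / 2) atTop atTop :=
      tendsto_atTop_add_const_left _ _ (tendsto_natCast_atTop_atTop.atTop_div_const (by norm_num))
    have h2 := (h1.inv_tendsto_atTop.rpow_const (p := β / k) (Or.inr (by positivity))).const_mul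
      (d : ℝ)
    rw [Real.zero_rpow (by positivity), mul_zero] at h2
    simpa only [one_div, Pi.inv_apply] using h2
  rw [Metric.tendstoUniformlyOn_iff]
  intro ε hε
  filter_upwards [hlim.eventually_lt_const hε] with n hn z hz
  rw [dist_zero_left]
  exact (norm_le_of_mem_localBasin hk hβ (by positivity)
    (iterate_mem_localBasin hk hR₁ hstep le_rfl hz n)).trans_lt hn

/-- The accumulated logarithmic relative error along the orbit of `z`. -/
def errLog (lam : Fin d → ℂ) (k : ℕ) (F : EuclideanSpace ℂ (Fin d) → EuclideanSpace ℂ (Fin d))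
    (z : EuclideanSpace ℂ (Fin d)) (j : Fin d) : ℂ :=
  ∑' n : ℕ, Complex.log (1 + relErr lam k F (F^[n] z) j)

/-- The exponent `2` is split as `1/2 + 3/2`: the power `3/2` keeps summability in `n`, and the
factor `R ^ (-1/2)` makes the total error small deep in the basin. The shift `n + 2` comes from `R +
n/2 ≥ (n + 2)/2`, and `4` dominates `2 ^ (3/2)`. -/
lemma inv_sq_add_half_le {R : ℝ} (hR : 1 ≤ R) (n : ℕ) :
    (1 / (R + n / 2)) ^ 2 ≤ 4 * R ^ (-(1 / 2) : ℝ) * (1 / |(n : ℝ) + 2| ^ (3 / 2 : ℝ)) := by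
  have hn : (0 : ℝ) ≤ n := Nat.cast_nonneg n
  have hx : 0 < R + n / 2 := by linarith
  rw [abs_of_nonneg (by linarith), one_div (R + _), inv_pow, Real.rpow_neg (by linarith), one_div (_ ^ _),
    show 4 * (R ^ (1 / 2 : ℝ))⁻¹ * ((n + 2 : ℝ) ^ (3 / 2 : ℝ))⁻¹ =
      (R ^ (1 / 2 : ℝ) * (n + 2 : ℝ) ^ (3 / 2 : ℝ) / 4)⁻¹ by field_simp]
  have hRpos : 0 < R ^ (1 / 2 : ℝ) := Real.rpow_pos_of_pos (by linarith) _
  have hnpos : 0 < (n + 2 : ℝ) ^ (3 / 2 : ℝ) := Real.rpow_pos_of_pos (by linarith) _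
  refine inv_anti₀ (by positivity) ?_
  have h1 : (R + n / 2) ^ 2 = (R + n / 2) ^ (1 / 2 : ℝ) * (R + n / 2) ^ (3 / 2 : ℝ) := by
    rw [← Real.rpow_add hx, ← Real.rpow_natCast]; norm_num
  have h2 : R ^ (1 / 2 : ℝ) ≤ (R + n / 2) ^ (1 / 2 : ℝ) := by gcongr; linarith
  have h3 : (n + 2 : ℝ) ^ (3 / 2 : ℝ) / 4 ≤ (R + n / 2) ^ (3 / 2 : ℝ) := by
    have h4 : (n + 2 : ℝ) ^ (3 / 2 : ℝ) = ((n + 2) / 2 : ℝ) ^ (3 / 2 : ℝ) * 2 ^ (3 / 2 : ℝ) := by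
      rw [← Real.mul_rpow (by linarith) (by norm_num)]; congr 1; ring
    have h5 : (2 : ℝ) ^ (3 / 2 : ℝ) ≤ 4 := by
      calc (2 : ℝ) ^ (3 / 2 : ℝ) ≤ 2 ^ (2 : ℝ) :=
            Real.rpow_le_rpow_of_exponent_le (by norm_num) (by norm_num)
        _ = 4 := by norm_num
    have h6 : ((n + 2) / 2 : ℝ) ^ (3 / 2 : ℝ) ≤ (R + n / 2) ^ (3 / 2 : ℝ) := by
      gcongr; linarith
    have h7 : 0 ≤ ((n + 2) / 2 : ℝ) ^ (3 / 2 : ℝ) := by positivity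
    rw [h4]; nlinarith
  rw [h1, mul_div_assoc]
  gcongr

lemma summable_inv_rpow : Summable fun n : ℕ => 1 / |(n : ℝ) + 2| ^ (3 / 2 : ℝ) :=
  (Real.summable_one_div_nat_add_rpow 2 (3 / 2)).2 (by norm_num)

lemma norm_log_one_add_relErr_le (hk : 1 ≤ k) (hR₁ : 1 ≤ R₁) (hK : 0 ≤ K)
    (hstep : ∀ z ∈ localBasin d k h R₁ θ β, StepEstimate lam k h θ β K U F z)
    {R : ℝ} (hR : R₁ ≤ R) {z : EuclideanSpace ℂ (Fin d)} (hz : z ∈ localBasin d k h R θ β)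
    (j : Fin d) (n : ℕ) :
    ‖Complex.log (1 + relErr lam k F (F^[n] z) j)‖ ≤
      6 * K * R ^ (-(1 / 2) : ℝ) * (1 / |(n : ℝ) + 2| ^ (3 / 2 : ℝ)) := by
  have hn : (0 : ℝ) ≤ n := Nat.cast_nonneg n
  have hmem := iterate_mem_localBasin hk hR₁ hstep hR hz n
  have hs := hstep _ (localBasin_subset hk (by linarith) (by linarith) hmem)
  have h1 := Complex.norm_log_one_add_half_le_self (hs.relErr_le_half j)
  have h2 := norm_coordProd_pow_le hk (by linarith) hmem
  have h3 := inv_sq_add_half_le (hR₁.trans hR) n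
  calc _ ≤ _ := h1
    _ ≤ 3 / 2 * (K * ‖coordProd (F^[n] z) ^ k‖ ^ 2) := by gcongr; exact hs.relErr_le j
    _ ≤ 3 / 2 * (K * (1 / (R + n / 2)) ^ 2) := by gcongr
    _ ≤ 3 / 2 * (K * (4 * R ^ (-(1 / 2) : ℝ) * (1 / |(n : ℝ) + 2| ^ (3 / 2 : ℝ)))) := by gcongr
    _ = _ := by ring

lemma iterate_apply_eq (hk : 1 ≤ k) (hR₁ : 1 ≤ R₁)
    (hstep : ∀ z ∈ localBasin d k h R₁ θ β, StepEstimate lam k h θ β K U F z)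
    {z : EuclideanSpace ℂ (Fin d)} (hz : z ∈ localBasin d k h R₁ θ β) (n : ℕ) (j : Fin d) :
    F^[n] z j = lam j ^ n * z j * Complex.exp
      (∑ m ∈ Finset.range n, Complex.log (1 - coordProd (F^[m] z) ^ k / (k * d)) +
        ∑ m ∈ Finset.range n, Complex.log (1 + relErr lam k F (F^[m] z) j)) := by
  induction n with
  | zero => simp
  | succ n ih =>
    have hs := hstep _ (localBasin_subset hk (by linarith)
      (le_add_of_nonneg_right (by positivity)) (iterate_mem_localBasin hk hR₁ hstep le_rfl hz n))
    rw [Function.iterate_succ_apply', hs.apply_eq, ih, Finset.sum_range_succ, Finset.sum_range_succ,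
      add_add_add_comm, Complex.exp_add (_ + _) (_ + _)]
    ring

lemma sectorLog_iterate_eq (hk : 1 ≤ k) (hR₁ : 1 ≤ R₁)
    (hstep : ∀ z ∈ localBasin d k h R₁ θ β, StepEstimate lam k h θ β K U F z)
    {z : EuclideanSpace ℂ (Fin d)} (hz : z ∈ localBasin d k h R₁ θ β) (n : ℕ) :
    sectorLog k h (coordProd (F^[n] z)) = sectorLog k h (coordProd z) +
      (d * ∑ m ∈ Finset.range n, Complex.log (1 - coordProd (F^[m] z) ^ k / (k * d)) +
        ∑ j, ∑ m ∈ Finset.range n, Complex.log (1 + relErr lam k F (F^[m] z) j)) := by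
  induction n with
  | zero => simp
  | succ n ih =>
    have hs := hstep _ (localBasin_subset hk (by linarith)
      (le_add_of_nonneg_right (by positivity)) (iterate_mem_localBasin hk hR₁ hstep le_rfl hz n))
    rw [Function.iterate_succ_apply', hs.sectorLog_eq, ih, stepLog]
    simp only [Finset.sum_range_succ, Finset.sum_add_distrib]
    ring

/-- The increments of `Y = 1/y` tend to `1`, so by Cesàro `Y_n / n → 1` and `arg Y_n → 0`. In the
sector this argument is exactly `-k` times the imaginary part in question, since `kθ < π/2` leaves
no branch ambiguity. -/
lemma tendsto_im_sectorLog (hk : 1 ≤ k) (hθ : θ < Real.pi / (2 * k)) (hR₁ : 1 ≤ R₁)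
    (hstep : ∀ z ∈ localBasin d k h R₁ θ β, StepEstimate lam k h θ β K U F z)
    {z : EuclideanSpace ℂ (Fin d)} (hz : z ∈ localBasin d k h R₁ θ β) :
    Tendsto (fun n => (sectorLog k h (coordProd (F^[n] z))).im) atTop (𝓝 0) := by
  have hk' : (0 : ℝ) < k := by exact_mod_cast hk
  have hmem := iterate_mem_localBasin hk hR₁ hstep le_rfl hz
  have hmem₁ : ∀ n, F^[n] z ∈ localBasin d k h R₁ θ β := fun n =>
    localBasin_subset hk (by linarith) (le_add_of_nonneg_right (by positivity)) (hmem n)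
  let Y : ℕ → ℂ := fun n => (coordProd (F^[n] z) ^ k)⁻¹
  have hR : Tendsto (fun n : ℕ => 1 / (R₁ + (n : ℝ) / 2)) atTop (𝓝 0) := by
    have h1 : Tendsto (fun n : ℕ => R₁ + (n : ℝ) / 2) atTop atTop :=
      tendsto_atTop_add_const_left _ _ (tendsto_natCast_atTop_atTop.atTop_div_const (by norm_num))
    simpa only [one_div] using! h1.inv_tendsto_atTop
  have hy : Tendsto (fun n => ‖coordProd (F^[n] z) ^ k‖) atTop (𝓝 0) :=
    squeeze_zero (fun _ => norm_nonneg _)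
      (fun n => norm_coordProd_pow_le hk (by positivity) (hmem n)) hR
  have hdiff : Tendsto (fun n => Y (n + 1) - Y n) atTop (𝓝 1) := by
    rw [tendsto_iff_norm_sub_tendsto_zero]
    refine squeeze_zero (fun _ => norm_nonneg _) (fun n => ?_)
      (g := fun n => K * ‖coordProd (F^[n] z) ^ k‖) (by simpa only [mul_zero] using hy.const_mul K)
    simp only [Y, Function.iterate_succ_apply']
    exact (hstep _ (hmem₁ n)).inv_sub_le
  have hces : Tendsto (fun n : ℕ => (n : ℝ)⁻¹ • Y n) atTop (𝓝 1) := by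
    have h1 := hdiff.cesaro_smul
    simp only [Finset.sum_range_sub] at h1
    have h2 : Tendsto (fun n : ℕ => (n : ℝ)⁻¹ • Y 0) atTop (𝓝 0) := by
      simpa using (tendsto_inv_atTop_nhds_zero_nat (𝕜 := ℝ)).smul_const (Y 0)
    have h3 := h1.add h2
    simp only [← smul_add, sub_add_cancel, add_zero] at h3
    exact h3
  have harg := (Complex.continuousAt_arg (x := 1) (by simp)).tendsto.comp hces
  rw [Complex.arg_one] at harg
  have h3 : ∀ᶠ n : ℕ in atTop, -(1 / (k : ℝ)) * (Complex.arg ((n : ℝ)⁻¹ • Y n)) =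
      (sectorLog k h (coordProd (F^[n] z))).im := by
    filter_upwards [eventually_gt_atTop 0] with n hn
    have hn' : (0 : ℝ) < n := by exact_mod_cast hn
    obtain ⟨h0, -, h2⟩ := (mem_attractingSector_iff hk (by linarith)).1 (hmem₁ n).2
    have him : (-(k * sectorLog k h (coordProd (F^[n] z)))).im =
        -(k * (sectorLog k h (coordProd (F^[n] z))).im) := by simp
    rw [Complex.real_smul, Complex.arg_real_mul _ (by positivity)]
    simp only [Y]
    rw [← exp_neg_mul_sectorLog hk h h0, arg_exp_of_abs_im_lt, him]
    · field_simp
    · rw [him, abs_neg, abs_mul, abs_of_pos hk']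
      rw [lt_div_iff₀ (by positivity)] at hθ
      nlinarith [Real.pi_pos]
  refine Tendsto.congr' h3 ?_
  simpa using harg.const_mul (-(1 / (k : ℝ)))

/-- The asymptotics of an orbit: up to positive real factors `exp (r n)` common to all coordinates,
`z_n` behaves like `lam ^ n c`. -/
lemma exists_phase (hd : 1 ≤ d) (hk : 1 ≤ k) (hθ : θ < Real.pi / (2 * k))
    (hR₁ : 1 ≤ R₁) (hK : 0 ≤ K) (hlam : ∀ j, ‖lam j‖ = 1)
    (hstep : ∀ z ∈ localBasin d k h R₁ θ β, StepEstimate lam k h θ β K U F z)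
    {z : EuclideanSpace ℂ (Fin d)} (hz : z ∈ localBasin d k h R₁ θ β) :
    ∃ c : Fin d → ℂ, (∀ j, ‖c j‖ = ‖z j‖ * Real.exp (errLog lam k F z j).re) ∧
      (∃ t : ℝ, 0 < t ∧ ∏ j, c j = t * sectorDir k h) ∧
      ∃ r : ℕ → ℝ, Tendsto (fun n j => (lam j ^ n)⁻¹ * F^[n] z j * Real.exp (-r n)) atTop (𝓝 c) := by
  have hd' : (d : ℝ) ≠ 0 := by exact_mod_cast (by omega : d ≠ 0)
  let A : ℕ → ℂ := fun n =>
    ∑ m ∈ Finset.range n, Complex.log (1 - coordProd (F^[m] z) ^ k / (k * d))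
  let E : ℕ → Fin d → ℂ := fun n j =>
    ∑ m ∈ Finset.range n, Complex.log (1 + relErr lam k F (F^[m] z) j)
  have hsum : ∀ j, Summable fun n => Complex.log (1 + relErr lam k F (F^[n] z) j) := fun j =>
    Summable.of_norm_bounded (summable_inv_rpow.mul_left _)
      (norm_log_one_add_relErr_le hk hR₁ hK hstep le_rfl hz j)
  have hE : ∀ j, Tendsto (fun n => E n j) atTop (𝓝 (errLog lam k F z j)) := fun j =>
    (hsum j).hasSum.tendsto_sum_nat
  set L := sectorLog k h (coordProd z) with hL_def
  set S := ∑ j, errLog lam k F z j with hS_def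
  have hES : Tendsto (fun n => ∑ j, E n j) atTop (𝓝 S) := tendsto_finsetSum _ fun j _ => hE j
  -- The imaginary part of `L_n = L + d A_n + ∑ E_n` tends to `0`, which forces this limit for `Im
  -- A_n`. Convergence of `Re A_n` is not needed: it is common to all coordinates and becomes the
  -- scaling `r n`.
  set a : ℝ := -(L.im + S.im) / d with ha_def
  have hA : Tendsto (fun n => (A n).im) atTop (𝓝 a) := by
    have h1 := tendsto_im_sectorLog hk hθ hR₁ hstep hz
    have h2 := (Complex.continuous_im.tendsto S).comp hES
    have h3 := ((h1.sub_const L.im).sub h2).div_const (d : ℝ)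
    rw [show (0 - L.im - S.im) / d = a by rw [ha_def]; ring] at h3
    refine h3.congr fun n => ?_
    rw [sectorLog_iterate_eq hk hR₁ hstep hz n]
    simp only [Function.comp_apply, Complex.add_im, ← hL_def]
    have : ((d : ℂ) * A n).im = d * (A n).im := by simp
    change (L.im + (((d : ℂ) * A n).im + (∑ j, E n j).im) - L.im - (∑ j, E n j).im) / d = _
    rw [this]
    field_simp
    ring
  have hu0 := coordProd_ne_zero_of_mem hk (by linarith) hz
  refine ⟨fun j => z j * Complex.exp (a * Complex.I + errLog lam k F z j), fun j => ?_,
    ⟨Real.exp (L.re + S.re), Real.exp_pos _, ?_⟩, fun n => (A n).re, ?_⟩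
  · rw [norm_mul, Complex.norm_exp]
    simp
  · rw [Finset.prod_mul_distrib, ← Complex.exp_sum, Finset.sum_add_distrib, ← hS_def]
    have h1 : ∏ j, z j = Complex.exp L * sectorDir k h := by
      rw [hL_def, exp_sectorLog k h hu0, div_mul_cancel₀ _ (sectorDir_ne_zero k h)]; rfl
    rw [h1, mul_right_comm, ← Complex.exp_add, Complex.ofReal_exp]
    congr 2
    apply Complex.ext
    · simp
    · simp only [Finset.sum_const, Finset.card_univ, Fintype.card_fin, nsmul_eq_mul]
      have : (L + (d * (a * Complex.I) + S)).im = L.im + (d * a + S.im) := by simp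
      rw [this, ha_def, Complex.ofReal_im]
      field_simp
      ring
  · refine tendsto_pi_nhds.2 fun j => ?_
    have h1 : Tendsto (fun n => z j * Complex.exp ((A n).im * Complex.I + E n j)) atTop
        (𝓝 (z j * Complex.exp (a * Complex.I + errLog lam k F z j))) := by
      refine Tendsto.const_mul _ ((Complex.continuous_exp.tendsto _).comp (Tendsto.add ?_ (hE j)))
      exact ((Complex.continuous_ofReal.tendsto _).comp hA).mul_const _
    refine h1.congr fun n => ?_
    have hl : lam j ^ n ≠ 0 := pow_ne_zero _ fun h => by simpa [h] using hlam j
    rw [iterate_apply_eq hk hR₁ hstep hz n j, mul_assoc (lam j ^ n), inv_mul_cancel_left₀ hl,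
      mul_assoc, Complex.ofReal_exp, ← Complex.exp_add]
    congr 2
    change _ = A n + E n j + _
    nth_rewrite 2 [← Complex.re_add_im (A n)]
    push_cast
    ring

end Basin

/-! ### Directions of orbits with a limiting phase -/

/-- Up to positive real factors common to all coordinates, `z_n` behaves like `lam ^ n c`. -/
def HasPhase {d : ℕ} (lam : Fin d → ℂ) (F : EuclideanSpace ℂ (Fin d) → EuclideanSpace ℂ (Fin d))
    (z : EuclideanSpace ℂ (Fin d)) (c : Fin d → ℂ) : Prop :=
  ∃ r : ℕ → ℝ, Tendsto (fun n j => (lam j ^ n)⁻¹ * F^[n] z j * Real.exp (-r n)) atTop (𝓝 c)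

lemma Complex.coe_arg_prod {ι : Type*} (s : Finset ι) {w : ι → ℂ} (hw : ∀ j, w j ≠ 0) :
    ((∏ j ∈ s, w j).arg : Real.Angle) = ∑ j ∈ s, ((w j).arg : Real.Angle) := by
  classical
  induction s using Finset.induction_on with
  | empty => simp
  | insert j s hj ih =>
    rw [Finset.prod_insert hj, Finset.sum_insert hj,
      Complex.arg_mul_coe_angle (hw j) (Finset.prod_ne_zero_iff.2 fun i _ => hw i), ih]

section Phase

variable {d k h : ℕ} {lam : Fin d → ℂ} {F : EuclideanSpace ℂ (Fin d) → EuclideanSpace ℂ (Fin d)}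
  {z : EuclideanSpace ℂ (Fin d)} {c : Fin d → ℂ}

/-- Allows the phase to be computed after the orbit has entered a deeper basin; the correction
factors have product `1` when `∏ lam = 1`. -/
lemma HasPhase.of_iterate {N : ℕ} (hc : HasPhase lam F (F^[N] z) c) :
    HasPhase lam F z (fun j => (lam j ^ N)⁻¹ * c j) := by
  obtain ⟨r, hr⟩ := hc
  -- The truncated subtraction is harmless, since only `n ≥ N` matters for the limit.
  refine ⟨fun n => r (n - N), (tendsto_add_atTop_iff_nat N).1 ?_⟩
  refine tendsto_pi_nhds.2 fun j => ((tendsto_pi_nhds.1 hr j).const_mul _).congr fun n => ?_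
  simp only [Nat.add_sub_cancel]
  rw [Function.iterate_add_apply, pow_add, mul_inv]
  ring

lemma norm_toLp_pos [NeZero d] (hc0 : ∀ j, c j ≠ 0) : 0 < ‖(WithLp.toLp 2 c : EuclideanSpace ℂ (Fin d))‖ := by
  rw [norm_pos_iff]
  intro h0
  exact hc0 0 (by simpa using congrArg (fun w : EuclideanSpace ℂ (Fin d) => w 0) h0)

/-- Dividing by the norm cancels the unknown scaling `r n`, and the unimodular `lam j` do not affect
the norm. -/
lemma HasPhase.tendsto_direction [NeZero d] (hlam : ∀ j, ‖lam j‖ = 1) (hc : HasPhase lam F z c)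
    (hc0 : ∀ j, c j ≠ 0) :
    Tendsto (fun n j => (lam j ^ n)⁻¹ * orbitDirection F z n j) atTop
      (𝓝 fun j => c j / ‖(WithLp.toLp 2 c : EuclideanSpace ℂ (Fin d))‖) := by
  obtain ⟨r, hr⟩ := hc
  have hN := norm_toLp_pos hc0
  have hnorm := (((PiLp.continuous_toLp 2 _).tendsto c).comp hr).norm
  refine tendsto_pi_nhds.2 fun j => ?_
  have h1 := (tendsto_pi_nhds.1 hr j).div
    ((Complex.continuous_ofReal.tendsto _).comp hnorm) (by exact_mod_cast hN.ne')
  refine h1.congr fun n => ?_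
  have h2 : ‖(WithLp.toLp 2 (fun j => (lam j ^ n)⁻¹ * F^[n] z j * Real.exp (-r n)) :
      EuclideanSpace ℂ (Fin d))‖ = ‖F^[n] z‖ * Real.exp (-r n) := by
    rw [EuclideanSpace.norm_eq, EuclideanSpace.norm_eq]
    rw [← Real.sqrt_sq (Real.exp_pos (-r n)).le, ← Real.sqrt_mul' _ (by positivity),
      Real.sqrt_sq (Real.exp_pos (-r n)).le, Finset.sum_mul]
    congr 1
    refine Finset.sum_congr rfl fun i _ => ?_
    simp only [norm_mul, norm_inv, norm_pow, hlam, one_pow, inv_one, one_mul,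
      Complex.norm_real, Real.norm_of_nonneg (Real.exp_pos _).le]
    rw [mul_pow]
  simp only [Pi.div_apply, Function.comp_apply, h2]
  have h3 : (Real.exp (-r n) : ℂ) ≠ 0 := by exact_mod_cast (Real.exp_pos _).ne'
  simp only [orbitDirection, PiLp.smul_apply, smul_eq_mul, Complex.ofReal_mul, Complex.ofReal_inv]
  rw [mul_div_mul_right _ _ h3]
  ring

lemma HasPhase.hasModulusDirection [NeZero d] (hlam : ∀ j, ‖lam j‖ = 1) (hc : HasPhase lam F z c)
    (hc0 : ∀ j, c j ≠ 0) :
    HasModulusDirection F z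
      (WithLp.toLp 2 fun j => ‖c j‖ / ‖(WithLp.toLp 2 c : EuclideanSpace ℂ (Fin d))‖) := by
  have h1 := tendsto_pi_nhds.1 (hc.tendsto_direction hlam hc0)
  have h2 : Tendsto (fun n j => ‖F^[n] z‖⁻¹ * ‖F^[n] z j‖) atTop
      (𝓝 fun j => ‖c j‖ / ‖(WithLp.toLp 2 c : EuclideanSpace ℂ (Fin d))‖) := by
    refine tendsto_pi_nhds.2 fun j => ?_
    have := (h1 j).norm
    rw [norm_div, Complex.norm_real, norm_norm] at this
    refine this.congr fun n => ?_
    simp [orbitDirection, hlam]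
  exact ((PiLp.continuous_toLp 2 _).tendsto _).comp h2

lemma coordProd_orbitDirection (hprod : ∏ j, lam j = 1) (n : ℕ) :
    ∏ j, (lam j ^ n)⁻¹ * orbitDirection F z n j = coordProd (orbitDirection F z n) := by
  rw [Finset.prod_mul_distrib, Finset.prod_inv_distrib, Finset.prod_pow, hprod, one_pow, inv_one,
    one_mul, coordProd]

lemma argSumCongr_iff {w : EuclideanSpace ℂ (Fin d)} (hw : ∀ j, w j ≠ 0) :
    ArgSumCongr k h w ↔ (coordProd w).arg = (sectorDir k h).arg := by
  rw [ArgSumCongr, ← Complex.coe_arg_prod _ hw, ← arg_sectorDir, coordProd,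
    Complex.arg_coe_angle_eq_iff]

/-- A torus of directions is an orbit of the group `∏ g = 1`. -/
lemma mem_phaseTorus_iff {v : EuclideanSpace ℝ (Fin d)} {ω : Fin d → ℂ} (hω0 : ∀ j, ω j ≠ 0)
    (hω : ∀ j, ‖ω j‖ = v j) (hωa : (∏ j, ω j).arg = (sectorDir k h).arg)
    {w : EuclideanSpace ℂ (Fin d)} :
    w ∈ phaseTorus k h v ↔
      ∃ g : Fin d → ℂ, (∀ j, ‖g j‖ = 1) ∧ ∏ j, g j = 1 ∧ ∀ j, w j = g j * ω j := by
  have hωp : ∏ j, ω j ≠ 0 := Finset.prod_ne_zero_iff.2 fun j _ => hω0 j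
  constructor
  · rintro ⟨h1, h2⟩
    have hwn : ∀ j, ‖w j‖ = ‖ω j‖ := fun j => by
      rw [hω, ← h1]; rfl
    have hw0 : ∀ j, w j ≠ 0 := fun j => by
      rw [← norm_pos_iff, hwn, norm_pos_iff]; exact hω0 j
    rw [argSumCongr_iff hw0, ← hωa] at h2
    refine ⟨fun j => w j / ω j, fun j => ?_, ?_, fun j => (div_mul_cancel₀ _ (hω0 j)).symm⟩
    · rw [norm_div, hwn, div_self (norm_ne_zero_iff.2 (hω0 j))]
    · rw [Finset.prod_div_distrib, div_eq_one_iff_eq hωp]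
      refine Complex.ext_norm_arg ?_ h2
      simp only [norm_prod, hwn]
  · rintro ⟨g, hg, hgp, hw⟩
    have hw0 : ∀ j, w j ≠ 0 := fun j => by
      rw [hw, ← norm_pos_iff, norm_mul, hg, one_mul, norm_pos_iff]; exact hω0 j
    refine ⟨?_, ?_⟩
    · ext j
      change ‖w j‖ = v j
      rw [hw, norm_mul, hg, one_mul, hω]
    · rw [argSumCongr_iff hw0, ← hωa]
      congr 1
      simp only [coordProd, hw, Finset.prod_mul_distrib, hgp, one_mul]

lemma HasPhase.conclusion [NeZero d] (hlam : ∀ j, ‖lam j‖ = 1) (hres : IsOneResonant lam 1)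
    (hc : HasPhase lam F z c) (hc0 : ∀ j, c j ≠ 0)
    (hca : (∏ j, c j).arg = (sectorDir k h).arg)
    (hz : Tendsto (fun n => F^[n] z) atTop (𝓝 0)) :
    ∃ v : EuclideanSpace ℝ (Fin d),
      HasModulusDirection F z v ∧ ‖v‖ = 1 ∧ (∀ j, 0 < v j) ∧
      directionLimitSet F z = phaseTorus k h v ∧
      ConvergesTangentTo F z (realCone (phaseTorus k h v)) := by
  have hprod := hres.prod_eq_one hlam
  have hN := norm_toLp_pos hc0
  have hdir := hc.tendsto_direction hlam hc0
  have hmod := hc.hasModulusDirection hlam hc0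
  set N := ‖(WithLp.toLp 2 c : EuclideanSpace ℂ (Fin d))‖ with hN_def
  set ω : Fin d → ℂ := fun j => c j / N with hω_def
  set v : EuclideanSpace ℝ (Fin d) := WithLp.toLp 2 fun j => ‖c j‖ / N with hv_def
  have hN0 : (N : ℂ) ≠ 0 := by exact_mod_cast hN.ne'
  have hω0 : ∀ j, ω j ≠ 0 := fun j => div_ne_zero (hc0 j) hN0
  have hωv : ∀ j, ‖ω j‖ = v j := fun j => by
    simp [hω_def, hv_def, abs_of_pos hN]
  have hωa : (∏ j, ω j).arg = (sectorDir k h).arg := by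
    have : ∏ j, ω j = ((N ^ d)⁻¹ : ℝ) * ∏ j, c j := by
      simp only [hω_def, Finset.prod_div_distrib, Finset.prod_const, Finset.card_univ,
        Fintype.card_fin]
      push_cast
      rw [div_eq_mul_inv, mul_comm]
    rw [this, Complex.arg_real_mul _ (by positivity), hca]
  have hlam0 : ∀ (n : ℕ) j, lam j ^ n ≠ 0 := fun n j =>
    pow_ne_zero _ fun h => by simpa [h] using hlam j
  have hmem : ∀ n : ℕ, (WithLp.toLp 2 fun j => lam j ^ n * ω j) ∈ phaseTorus k h v := fun n =>
    (mem_phaseTorus_iff hω0 hωv hωa).2 ⟨fun j => lam j ^ n, fun j => by rw [norm_pow, hlam, one_pow],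
      by rw [Finset.prod_pow, hprod, one_pow], fun j => rfl⟩
  refine ⟨v, hmod, ?_, fun j => div_pos (norm_pos_iff.2 (hc0 j)) hN, ?_, hz, ?_⟩
  · have h1 : v = N⁻¹ • modulusVector (WithLp.toLp 2 c) := by
      ext j
      simp [hv_def, modulusVector, div_eq_inv_mul]
    have h2 : ‖modulusVector (WithLp.toLp 2 c : EuclideanSpace ℂ (Fin d))‖ = N := by
      rw [hN_def, EuclideanSpace.norm_eq, EuclideanSpace.norm_eq]
      simp [modulusVector]
    rw [h1, norm_smul, h2, norm_inv, Real.norm_of_nonneg hN.le, inv_mul_cancel₀ hN.ne']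
  · ext w
    constructor
    · intro hw
      obtain ⟨ψ, hψ, hlim⟩ := MapClusterPt.tendsto_subseq hw
      have hlimj : ∀ j, Tendsto (fun n => orbitDirection F z (ψ n) j) atTop (𝓝 (w j)) := fun j =>
        ((PiLp.continuous_apply 2 _ j).tendsto w).comp hlim
      have hdirj := fun j => (tendsto_pi_nhds.1 hdir j).comp hψ.tendsto_atTop
      -- Coordinate moduli and the product of the coordinates do not see the rotation by `lam ^ n`,
      -- so both converge along the whole orbit and are inherited by every accumulation point.
      have hwn : ∀ j, ‖w j‖ = ‖ω j‖ := fun j => by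
        refine tendsto_nhds_unique (hlimj j).norm ((hdirj j).norm.congr fun n => ?_)
        simp [hlam]
      have hwp : coordProd w = ∏ j, ω j := by
        refine tendsto_nhds_unique (f := fun n => coordProd (orbitDirection F z (ψ n)))
          (tendsto_finsetProd _ fun j _ => hlimj j)
          ((tendsto_finsetProd Finset.univ fun j _ => hdirj j).congr fun n => ?_)
        exact coordProd_orbitDirection hprod (ψ n)
      have hw0 : ∀ j, w j ≠ 0 := fun j => by
        rw [← norm_pos_iff, hwn, norm_pos_iff]; exact hω0 j
      refine ⟨?_, ?_⟩
      · ext j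
        exact (hwn j).trans (hωv j)
      · rw [argSumCongr_iff hw0, hwp, hωa]
    · intro hw
      -- Along a subsequence with `lam ^ n → g`, the directions tend to `g ω = w`.
      obtain ⟨g, hg, hgp, hwg⟩ := (mem_phaseTorus_iff hω0 hωv hωa).1 hw
      obtain ⟨ψ, hψ, hlim⟩ := MapClusterPt.tendsto_subseq (hres.mapClusterPt_pow hlam 0 hg hgp)
      have h1 := hlim.mul (hdir.comp hψ.tendsto_atTop)
      have h2 : WithLp.toLp 2 (g * ω) = w := by
        ext j
        exact (hwg j).symm
      have h3 : Tendsto (fun n => orbitDirection F z (ψ n)) atTop (𝓝 w) := by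
        rw [← h2]
        refine (((PiLp.continuous_toLp 2 _).tendsto _).comp h1).congr fun n => ?_
        ext j
        simp [hlam0]
      exact MapClusterPt.of_comp hψ.tendsto_atTop h3.mapClusterPt
  · have h1 : Tendsto (fun n => ‖WithLp.toLp 2 ((fun j => (lam j ^ n)⁻¹ * orbitDirection F z n j) - ω)‖)
        atTop (𝓝 0) := by
      have h2 := ((PiLp.continuous_toLp 2 (fun _ : Fin d => ℂ)).tendsto _).comp (hdir.sub_const ω)
      simpa using h2.norm
    refine isLittleO_iff.2 fun ε hε => ?_
    filter_upwards [h1.eventually_lt_const hε] with n hn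
    rw [norm_norm, Real.norm_of_nonneg Metric.infDist_nonneg]
    -- The comparison point `‖z_n‖ lam^n ω` of the cone is at distance `‖z_n‖ o(1)` from `z_n`.
    have h3 : ((‖F^[n] z‖ : ℝ) : ℂ) • (WithLp.toLp 2 fun j => lam j ^ n * ω j) ∈
        realCone (phaseTorus k h v) := ⟨‖F^[n] z‖, norm_nonneg _, _, hmem n, rfl⟩
    refine (Metric.infDist_le_dist_of_mem h3).trans ?_
    rcases eq_or_ne (F^[n] z) 0 with h0 | h0
    · simp [h0]
    have h4 : F^[n] z = ((‖F^[n] z‖ : ℝ) : ℂ) • orbitDirection F z n := by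
      rw [orbitDirection, smul_smul, ← Complex.ofReal_mul, mul_inv_cancel₀ (norm_ne_zero_iff.2 h0)]
      simp
    have h5 : ‖orbitDirection F z n - WithLp.toLp 2 fun j => lam j ^ n * ω j‖ =
        ‖WithLp.toLp 2 ((fun j => (lam j ^ n)⁻¹ * orbitDirection F z n j) - ω)‖ := by
      rw [EuclideanSpace.norm_eq, EuclideanSpace.norm_eq]
      congr 1
      refine Finset.sum_congr rfl fun j _ => ?_
      congr 1
      change ‖orbitDirection F z n j - lam j ^ n * ω j‖ =
        ‖(lam j ^ n)⁻¹ * orbitDirection F z n j - ω j‖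
      have : (lam j ^ n)⁻¹ * orbitDirection F z n j - ω j =
        (lam j ^ n)⁻¹ * (orbitDirection F z n j - lam j ^ n * ω j) := by
        rw [mul_sub, inv_mul_cancel_left₀ (hlam0 n j)]
      rw [this, norm_mul, norm_inv, norm_pow, hlam, one_pow, inv_one, one_mul]
    rw [dist_eq_norm]
    nth_rewrite 1 [h4]
    rw [← smul_sub, norm_smul, Complex.norm_real, norm_norm, h5, mul_comm]
    gcongr

end Phase

/-! ### Realizing every modulus direction -/

/-- A small perturbation of the identity that is holomorphic along complex lines attains the
centre of the ball on which it is controlled. -/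
lemma exists_add_re_eq {ι : Type*} [Fintype ι] {a : ι → ℝ} {δ : ℝ} (hδ : 0 < δ)
    {Φ : (ι → ℂ) → ι → ℂ}
    (hb : ∀ ζ : ι → ℂ, (∀ i, ‖ζ i - a i‖ < δ) → ∀ j, ‖Φ ζ j‖ ≤ δ / 8)
    (hd : ∀ (p q : ι → ℂ) (s : Set ℂ), IsOpen s → (∀ t ∈ s, ∀ i, ‖p i + t * q i - a i‖ < δ) →
      ∀ j, DifferentiableOn ℂ (fun t : ℂ => Φ (fun i => p i + t * q i) j) s) :
    ∃ x : ι → ℝ, (∀ i, |x i - a i| ≤ δ / 8) ∧ ∀ j, x j + (Φ (fun i => (x i : ℂ)) j).re = a j := by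
  let T : (ι → ℝ) → ι → ℝ := fun x j => a j - (Φ (fun i => (x i : ℂ)) j).re
  have hmem : ∀ x ∈ Metric.closedBall a (δ / 8), ∀ i, |x i - a i| ≤ δ / 8 := by
    intro x hx i
    rw [← Real.dist_eq]
    exact (dist_le_pi_dist x a i).trans hx
  have hball : ∀ x ∈ Metric.closedBall a (δ / 8), ∀ i, ‖((x i : ℝ) : ℂ) - a i‖ < δ := by
    intro x hx i
    rw [← Complex.ofReal_sub, Complex.norm_real, Real.norm_eq_abs]
    linarith [hmem x hx i]
  have hmaps : Set.MapsTo T (Metric.closedBall a (δ / 8)) (Metric.closedBall a (δ / 8)) := by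
    intro x hx
    rw [Metric.mem_closedBall, dist_pi_le_iff (by positivity)]
    intro j
    rw [Real.dist_eq]
    simp only [T, sub_sub_cancel_left, abs_neg]
    exact (Complex.abs_re_le_norm _).trans (hb _ (hball x hx) j)
  have hlip : ∀ x ∈ Metric.closedBall a (δ / 8), ∀ y ∈ Metric.closedBall a (δ / 8),
      dist (T x) (T y) ≤ 1 / 2 * dist x y := by
    intro x hx y hy
    rcases eq_or_ne x y with rfl | hxy
    · simp
    have hD : 0 < dist x y := dist_pos.2 hxy
    have hD' : dist x y ≤ δ / 4 := by
      refine (dist_triangle_right x y a).trans ?_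
      have h1 : dist x a ≤ δ / 8 := hx
      have h2 : dist y a ≤ δ / 8 := hy
      linarith
    have hq : ∀ i, ‖((y i : ℝ) : ℂ) - x i‖ ≤ dist x y := fun i => by
      rw [← Complex.ofReal_sub, Complex.norm_real, ← dist_eq_norm, dist_comm]
      exact dist_le_pi_dist x y i
    have hline : ∀ t ∈ Metric.ball (0 : ℂ) (δ / 2 / dist x y), ∀ i,
        ‖((x i : ℝ) : ℂ) + t * ((y i : ℂ) - x i) - a i‖ < δ := by
      intro t ht i
      rw [mem_ball_zero_iff, lt_div_iff₀ hD] at ht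
      have h1 : ((x i : ℝ) : ℂ) + t * ((y i : ℂ) - x i) - a i =
        ((x i : ℂ) - a i) + t * ((y i : ℂ) - x i) := by ring
      rw [h1]
      refine (norm_add_le _ _).trans_lt ?_
      rw [norm_mul, ← Complex.ofReal_sub (x i), Complex.norm_real, Real.norm_eq_abs]
      have h2 : ‖t‖ * ‖((y i : ℝ) : ℂ) - x i‖ ≤ ‖t‖ * dist x y := by gcongr; exact hq i
      linarith [hmem x hx i]
    rw [dist_pi_le_iff (by positivity)]
    intro j
    let f : ℂ → ℂ := fun t => Φ (fun i => ((x i : ℝ) : ℂ) + t * ((y i : ℂ) - x i)) j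
    have hf0 : f 0 = Φ (fun i => (x i : ℂ)) j := by simp [f]
    have hf1 : f 1 = Φ (fun i => (y i : ℂ)) j := by simp [f]
    have h0 : (0 : ℂ) ∈ Metric.ball (0 : ℂ) (δ / 2 / dist x y) :=
      Metric.mem_ball_self (by positivity)
    -- The Schwarz lemma on the complex line through `x` and `y`: a disc of radius `δ / (2 dist x
    -- y)` is mapped into one of radius `δ / 4`, so the values at `0` and `1` differ by at most
    -- `dist x y / 2`.
    have hS := Complex.dist_le_div_mul_dist_of_mapsTo_ball (f := f) (c := 0) (z := 1)
      (R₁ := δ / 2 / dist x y) (R₂ := δ / 4) (hd _ _ _ Metric.isOpen_ball hline j)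
      (fun t ht => by
        rw [Metric.mem_closedBall, dist_eq_norm]
        have h1 := hb _ (hline t ht) j
        have h2 := hb _ (hline 0 h0) j
        refine (norm_sub_le _ _).trans ?_
        change ‖f t‖ ≤ _ at h1
        change ‖f 0‖ ≤ _ at h2
        linarith)
      (by rw [mem_ball_zero_iff, norm_one, lt_div_iff₀ hD]; linarith)
    rw [hf0, hf1, dist_zero_right, norm_one, mul_one] at hS
    have h3 : dist (T x j) (T y j) ≤ dist (Φ (fun i => (y i : ℂ)) j) (Φ (fun i => (x i : ℂ)) j) := by
      rw [Real.dist_eq, dist_eq_norm]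
      simp only [T, sub_sub_sub_cancel_left, ← Complex.sub_re]
      exact Complex.abs_re_le_norm _
    refine h3.trans (hS.trans (le_of_eq ?_))
    field_simp
    norm_num
  obtain ⟨x, hx, hfix, -⟩ := ContractingWith.exists_fixedPoint' (K := 1 / 2)
    Metric.isClosed_closedBall.isComplete hmaps
    ⟨by norm_num, LipschitzWith.of_dist_le_mul fun x y =>
      (hlip x x.2 y y.2).trans_eq (by simp [Subtype.dist_eq])⟩
    (Metric.mem_closedBall_self (by positivity)) (edist_ne_top a (T a))
  refine ⟨x, hmem x hx, fun j => ?_⟩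
  have := congrFun hfix j
  simp only [T] at this
  linarith

section Realize

variable {d k h : ℕ} {θ β : ℝ} {lam : Fin d → ℂ} {K R₁ : ℝ} {U : Set (EuclideanSpace ℂ (Fin d))}
  {F : EuclideanSpace ℂ (Fin d) → EuclideanSpace ℂ (Fin d)}

/-- Each term is holomorphic and the series converges normally on the basin. Holomorphy along
one-parameter curves suffices, because it serves only the Schwarz lemma on complex lines. -/
lemma differentiableOn_errLog (hd : 1 ≤ d) (hk : 1 ≤ k) (hR₁ : 1 ≤ R₁) (hK : 0 ≤ K)
    (hlam : ∀ j, ‖lam j‖ = 1) (hF : DifferentiableOn ℂ F U)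
    (hstep : ∀ z ∈ localBasin d k h R₁ θ β, StepEstimate lam k h θ β K U F z)
    {γ : ℂ → EuclideanSpace ℂ (Fin d)} {s : Set ℂ} (hs : IsOpen s) (hγ : DifferentiableOn ℂ γ s)
    (hγs : Set.MapsTo γ s (localBasin d k h R₁ θ β)) (j : Fin d) :
    DifferentiableOn ℂ (fun t => errLog lam k F (γ t) j) s := by
  have hmem : ∀ n, ∀ t ∈ s, F^[n] (γ t) ∈ localBasin d k h R₁ θ β := fun n t ht =>
    localBasin_subset hk (by linarith) (le_add_of_nonneg_right (by positivity))
      (iterate_mem_localBasin hk hR₁ hstep le_rfl (hγs ht) n)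
  have hiter : ∀ n, DifferentiableOn ℂ (fun t => F^[n] (γ t)) s := by
    intro n
    induction n with
    | zero => simpa using hγ
    | succ n ih =>
      simp only [Function.iterate_succ_apply']
      exact hF.comp ih fun t ht => (hstep _ (hmem n t ht)).mem
  refine Complex.differentiableOn_tsum_of_summable_norm
    (summable_inv_rpow.mul_left (6 * K * R₁ ^ (-(1 / 2) : ℝ))) (fun n => ?_) hs
    (fun n t ht => norm_log_one_add_relErr_le hk hR₁ hK hstep le_rfl (hγs ht) j n)
  have hcoord : ∀ i, DifferentiableOn ℂ (fun t => F^[n] (γ t) i) s :=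
    differentiableOn_euclidean.1 (hiter n)
  have hcoord' : DifferentiableOn ℂ (fun t => F (F^[n] (γ t)) j) s := by
    have := hF.comp (hiter n) fun t ht => (hstep _ (hmem n t ht)).mem
    exact differentiableOn_euclidean.1 this j
  have hprodd : DifferentiableOn ℂ (fun t => coordProd (F^[n] (γ t))) s := by
    simp only [coordProd]
    exact DifferentiableOn.fun_finsetProd fun i _ => hcoord i
  have hrel : DifferentiableOn ℂ (fun t => relErr lam k F (F^[n] (γ t)) j) s := by
    refine (hcoord'.div (((hcoord j).const_mul (lam j)).mul
      (((hprodd.pow k).div_const _).const_sub 1)) fun t ht => ?_).sub_const 1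
    have hs' := hstep _ (hmem n t ht)
    have hA := half_le_norm_one_sub ((norm_div_nat_mul_nat_le hd hk _).trans hs'.norm_pow_le)
    refine mul_ne_zero (mul_ne_zero (fun h => by simpa [h] using hlam j) ?_)
      (norm_pos_iff.1 (one_half_pos.trans_le hA))
    exact coordProd_ne_zero_iff.1 (coordProd_ne_zero_of_mem hk (by linarith) (hmem n t ht)) j
  refine (hrel.const_add 1).clog fun t ht => Complex.mem_slitPlane_of_norm_lt_one ?_
  have := (hstep _ (hmem n t ht)).relErr_le_half j
  linarith

/-- The point with logarithmic coordinates `ζ - τ + 2πih/(kd)`. -/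
def expPoint (d k h : ℕ) (τ : ℝ) (ζ : Fin d → ℂ) : EuclideanSpace ℂ (Fin d) :=
  WithLp.toLp 2 fun j => Complex.exp
    (ζ j - τ + ((2 * Real.pi * h / k : ℝ) : ℂ) * Complex.I / d)

lemma norm_expPoint_apply (τ : ℝ) (ζ : Fin d → ℂ) (j : Fin d) :
    ‖expPoint d k h τ ζ j‖ = Real.exp ((ζ j).re - τ) := by
  simp only [expPoint, Complex.norm_exp]
  congr 1
  rw [mul_div_assoc, mul_comm]
  simp [Complex.div_re, Complex.mul_re, Complex.div_im]

lemma coordProd_expPoint (hd : 1 ≤ d) (τ : ℝ) (ζ : Fin d → ℂ) :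
    coordProd (expPoint d k h τ ζ) = sectorDir k h * Complex.exp (∑ j, ζ j - d * τ) := by
  have hd' : (d : ℂ) ≠ 0 := by exact_mod_cast (by omega : d ≠ 0)
  simp only [coordProd, expPoint, ← Complex.exp_sum, sectorDir, ← Complex.exp_add]
  congr 1
  simp only [Finset.sum_add_distrib, Finset.sum_sub_distrib, Finset.sum_const, Finset.card_univ,
    Fintype.card_fin, nsmul_eq_mul]
  field_simp
  ring

/-- Scaling by `exp (-τ)` with `τ` large enters the basin: since `dβ < 1`, the quantity `log |z j| -
β log |u|` tends to `-∞`, and so does `log |u|`. The polydisc radius `θ / (2d)` keeps the argument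
of `u` within `θ / 2` of the axis of the sector. -/
lemma exists_expPoint_mem (hd : 1 ≤ d) (hk : 1 ≤ k) (hβ : 0 < β) (hβd : d * β < 1)
    (hθ₀ : 0 < θ) (hθ : θ < Real.pi / (2 * k)) {R : ℝ} (hR : 0 < R) (a : Fin d → ℝ) :
    ∃ τ : ℝ, ∀ ζ : Fin d → ℂ, (∀ i, ‖ζ i - a i‖ < θ / (2 * d)) →
      expPoint d k h τ ζ ∈ localBasin d k h R θ β := by
  have hd' : (0 : ℝ) < d := by exact_mod_cast hd
  have hk' : (0 : ℝ) < k := by exact_mod_cast hk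
  have hkθ : k * θ < Real.pi / 2 := by
    have := hθ
    rw [lt_div_iff₀ (by positivity)] at this
    linarith
  have hκ : 0 < Real.cos (k * θ) :=
    Real.cos_pos_of_mem_Ioo ⟨by linarith [Real.pi_pos, mul_pos hk' hθ₀], hkθ⟩
  have hk1 : Real.pi / (2 * k) ≤ Real.pi := by
    refine div_le_self Real.pi_pos.le ?_
    have : (1 : ℝ) ≤ k := by exact_mod_cast hk
    linarith
  set M : ℝ := ∑ i, (|a i| + θ / (2 * d)) with hM
  -- `M` bounds `Re ζ j` and `|∑ Re ζ j|`. The first lower bound on `τ` yields the moduli condition,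
  -- the second `R < cos (kθ) exp (k(dτ - M))`, hence `R < Re (1/y)`.
  obtain ⟨τ, hτ⟩ := exists_gt (max ((1 + β) * M / (1 - d * β))
    ((Real.log (R / Real.cos (k * θ)) / k + M) / d))
  obtain ⟨hτ1, hτ2⟩ := max_lt_iff.1 hτ
  rw [div_lt_iff₀ (by linarith)] at hτ1
  rw [div_lt_iff₀ hd'] at hτ2
  have hτ3 : Real.log (R / Real.cos (k * θ)) < (d * τ - M) * k := by
    rw [← div_lt_iff₀ hk']; linarith
  rw [Real.log_lt_iff_lt_exp (by positivity), div_lt_iff₀ hκ] at hτ3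
  refine ⟨τ, fun ζ hζ => ?_⟩
  have hre : ∀ i, |(ζ i).re| ≤ |a i| + θ / (2 * d) := fun i => by
    have h1 := (Complex.abs_re_le_norm _).trans (hζ i).le
    have h2 := abs_add_le (a i) ((ζ i).re - a i)
    rw [add_sub_cancel] at h2
    simp only [Complex.sub_re, Complex.ofReal_re] at h1
    linarith
  have him : ∀ i, |(ζ i).im| ≤ θ / (2 * d) := fun i => by
    simpa using (Complex.abs_im_le_norm _).trans (hζ i).le
  have hreM : |(∑ i, ζ i).re| ≤ M := by
    rw [Complex.re_sum]
    exact (Finset.abs_sum_le_sum_abs _ _).trans (Finset.sum_le_sum fun i _ => hre i)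
  have hreiM : ∀ i, (ζ i).re ≤ M := fun i =>
    (le_abs_self _).trans ((hre i).trans (Finset.single_le_sum
      (f := fun i => |a i| + θ / (2 * d)) (fun i _ => by positivity) (Finset.mem_univ i)))
  have himS : |(∑ i, ζ i).im| < θ := by
    rw [Complex.im_sum]
    refine ((Finset.abs_sum_le_sum_abs _ _).trans (Finset.sum_le_sum fun i _ => him i)).trans_lt ?_
    simp only [Finset.sum_const, Finset.card_univ, Fintype.card_fin, nsmul_eq_mul]
    rw [show d * (θ / (2 * d)) = θ / 2 by field_simp]
    linarith
  set L : ℂ := ∑ j, ζ j - d * τ with hL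
  have hLre : L.re = (∑ i, ζ i).re - d * τ := by simp [hL]
  have hLim : L.im = (∑ i, ζ i).im := by simp [hL]
  have hu := coordProd_expPoint (k := k) (h := h) hd τ ζ
  rw [← hL] at hu
  have hu0 : coordProd (expPoint d k h τ ζ) ≠ 0 := by
    rw [hu]; exact mul_ne_zero (sectorDir_ne_zero k h) (Complex.exp_ne_zero _)
  have hlog : sectorLog k h (coordProd (expPoint d k h τ ζ)) = L := by
    have h1 : sectorLog k h (sectorDir k h) = 0 := by
      rw [sectorLog, div_self (sectorDir_ne_zero k h), Complex.log_one]
    rw [hu, sectorLog_mul_exp k h (sectorDir_ne_zero k h), h1, zero_add]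
    rw [h1, zero_add, hLim]
    linarith
  refine ⟨fun j => ?_, (mem_attractingSector_iff hk hR).2 ⟨hu0, ?_, ?_⟩⟩
  · rw [norm_expPoint_apply, hu, norm_mul, norm_sectorDir, one_mul, Complex.norm_exp,
      ← Real.exp_mul, Real.exp_lt_exp, hLre]
    have h1 := (abs_le.1 hreM).1
    have h2 := hreiM j
    nlinarith
  · rw [← exp_neg_mul_sectorLog hk h hu0, hlog, Complex.exp_re]
    have h1 : (-((k : ℂ) * L)).re = -(k * L.re) := by simp
    have h2 : (-((k : ℂ) * L)).im = -(k * L.im) := by simp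
    rw [h1, h2, Real.cos_neg, ← Real.cos_abs, abs_mul, abs_of_pos hk', hLim]
    refine hτ3.trans_le ?_
    have h3 : Real.cos (k * θ) ≤ Real.cos (k * |(∑ i, ζ i).im|) :=
      Real.cos_le_cos_of_nonneg_of_le_pi (by positivity) (by linarith [Real.pi_pos]) (by gcongr)
    have h4 : (d * τ - M) * k ≤ -(k * L.re) := by
      have := (abs_le.1 hreM).2
      rw [hLre]
      nlinarith
    gcongr
  · rwa [hlog, hLim]

/-- In the coordinates `x j = log |z j| + τ` the equation reads `x j + Re errLog_j = log (v j)`,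
with `s = exp (-τ)`; `exists_add_re_eq` solves it. -/
lemma exists_mem_norm_mul_exp_eq (hd : 1 ≤ d) (hk : 1 ≤ k) (hβ : 0 < β) (hβd : d * β < 1)
    (hθ₀ : 0 < θ) (hθ : θ < Real.pi / (2 * k)) (hR₁ : 1 ≤ R₁) (hK : 0 ≤ K)
    (hlam : ∀ j, ‖lam j‖ = 1) (hF : DifferentiableOn ℂ F U)
    (hstep : ∀ z ∈ localBasin d k h R₁ θ β, StepEstimate lam k h θ β K U F z)
    {R : ℝ} (hR : R₁ ≤ R) {v : Fin d → ℝ} (hv : ∀ j, 0 < v j) :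
    ∃ z ∈ localBasin d k h R θ β, ∃ s : ℝ, 0 < s ∧
      ∀ j, ‖z j‖ * Real.exp (errLog lam k F z j).re = s * v j := by
  have hd' : (0 : ℝ) < d := by exact_mod_cast hd
  set δ : ℝ := θ / (2 * d) with hδ_def
  have hδ : 0 < δ := by positivity
  set W : ℝ := ∑' n : ℕ, 1 / |(n : ℝ) + 2| ^ (3 / 2 : ℝ) with hW
  -- The total error decays like `R' ^ (-1/2)`, so a deep enough basin brings it below `δ / 8`.
  obtain ⟨R', hR'R, hR'⟩ : ∃ R', R ≤ R' ∧ 6 * K * R' ^ (-(1 / 2) : ℝ) * W ≤ δ / 8 := by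
    have h1 : Tendsto (fun x : ℝ => 6 * K * x ^ (-(1 / 2) : ℝ) * W) atTop (𝓝 0) := by
      simpa using ((tendsto_rpow_neg_atTop (y := 1 / 2) (by norm_num)).const_mul (6 * K)).mul_const W
    obtain ⟨R', h2, h3⟩ := ((h1.eventually_le_const (show (0 : ℝ) < δ / 8 by positivity)).and
      (eventually_ge_atTop R)).exists
    exact ⟨R', h3, h2⟩
  have hstep' : ∀ z ∈ localBasin d k h R' θ β, StepEstimate lam k h θ β K U F z := fun z hz =>
    hstep z (localBasin_subset hk (by linarith) (hR.trans hR'R) hz)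
  have hsmall : ∀ z ∈ localBasin d k h R' θ β, ∀ j, ‖errLog lam k F z j‖ ≤ δ / 8 := fun z hz j =>
    (tsum_of_norm_bounded (summable_inv_rpow.mul_left _).hasSum
      (norm_log_one_add_relErr_le hk hR₁ hK hstep (hR.trans hR'R) hz j)).trans
      (by rw [tsum_mul_left]; exact hR')
  obtain ⟨τ, hτ⟩ := exists_expPoint_mem (h := h) hd hk hβ hβd hθ₀ hθ
    (show 0 < R' by linarith) (fun j => Real.log (v j))
  obtain ⟨x, hx, hxv⟩ := exists_add_re_eq (a := fun j => Real.log (v j)) hδ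
    (Φ := fun ζ j => errLog lam k F (expPoint d k h τ ζ) j)
    (fun ζ hζ j => hsmall _ (hτ ζ hζ) j)
    (fun p q s hs hpq j => differentiableOn_errLog hd hk (by linarith) hK hlam hF hstep' hs
      (differentiableOn_euclidean.2 fun i => by
        simp only [expPoint]
        fun_prop) (fun t ht => hτ _ (hpq t ht)) j)
  have hxmem : expPoint d k h τ (fun i => (x i : ℂ)) ∈ localBasin d k h R' θ β := by
    refine hτ _ fun i => ?_
    rw [← Complex.ofReal_sub, Complex.norm_real, Real.norm_eq_abs]
    linarith [hx i]
  refine ⟨_, localBasin_subset hk (by linarith) hR'R hxmem, Real.exp (-τ), Real.exp_pos _,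
    fun j => ?_⟩
  rw [norm_expPoint_apply, ← Real.exp_add, ← Real.exp_log (hv j), ← Real.exp_add, ← hxv j,
    Complex.ofReal_re]
  congr 1
  ring

end Realize

/-- Inside the cone `Re (1/y) ≥ cos (kθ) / |y|`, which exceeds any `R'` once `y` is small. This
transfers the estimates for the radius `R₁` to an arbitrary uniform basin. -/
lemma eventually_iterate_mem_localBasin {d k h : ℕ} (hk : 1 ≤ k) {R θ β : ℝ} (hR : 0 < R)
    (hθ₀ : 0 < θ) (hθ : θ < Real.pi / (2 * k)) {z : ℕ → EuclideanSpace ℂ (Fin d)} (hd : 1 ≤ d)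
    (hz : ∀ n, z n ∈ localBasin d k h R θ β) (hz0 : Tendsto z atTop (𝓝 0)) (R' : ℝ) (hR' : 0 < R') :
    ∀ᶠ n in atTop, z n ∈ localBasin d k h R' θ β := by
  have hk' : (0 : ℝ) < k := by exact_mod_cast hk
  have hkθ : k * θ < Real.pi / 2 := by
    have := hθ
    rw [lt_div_iff₀ (by positivity)] at this
    linarith
  have hκ : 0 < Real.cos (k * θ) :=
    Real.cos_pos_of_mem_Ioo ⟨by linarith [Real.pi_pos, mul_pos hk' hθ₀], hkθ⟩
  have hcont : Continuous fun w : EuclideanSpace ℂ (Fin d) => coordProd w ^ k := by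
    unfold coordProd; fun_prop
  have h1 : Tendsto (fun n => R' * ‖coordProd (z n) ^ k‖) atTop (𝓝 0) := by
    have h2 := ((hcont.tendsto 0).comp hz0).norm.const_mul R'
    have h3 : coordProd (0 : EuclideanSpace ℂ (Fin d)) = 0 :=
      Finset.prod_eq_zero (Finset.mem_univ ⟨0, hd⟩) rfl
    simpa [h3, zero_pow (by omega : k ≠ 0), -norm_pow] using h2
  filter_upwards [h1.eventually_lt_const hκ] with n hn
  obtain ⟨h0, -, hL⟩ := (mem_attractingSector_iff hk hR).1 (hz n).2
  refine ⟨(hz n).1, (mem_attractingSector_iff hk hR').2 ⟨h0, ?_, hL⟩⟩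
  have h2 := cos_mul_norm_le_re hk hθ h0 hL
  have h3 : 0 < ‖coordProd (z n) ^ k‖ := norm_pos_iff.2 (pow_ne_zero _ h0)
  rw [Complex.inv_re, Complex.normSq_eq_norm_sq, lt_div_iff₀ (by positivity)]
  nlinarith

end

theorem mainTheorem7 (d k l : ℕ) (hk : 1 ≤ k) (hl : 2 * k * d + 1 < l)
    (lam : Fin d → ℂ) (hlam : ∀ j, ‖lam j‖ = 1) (hres : IsOneResonant lam 1)
    (U : Set (EuclideanSpace ℂ (Fin d))) (hU : IsOpen U) (hU0 : 0 ∈ U)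
    (F : EuclideanSpace ℂ (Fin d) → EuclideanSpace ℂ (Fin d))
    (hF : DifferentiableOn ℂ F U)
    (hFN : (fun z => F z - normalForm lam k z) =O[𝓝 0] (fun z => ‖z‖ ^ l))
    (β₀ : ℝ) (hβ₀ : 0 < β₀) (hβ₀d : β₀ < 1 / d) (hβ₀l : 2 * (k : ℝ) + 1 < β₀ * ((l : ℝ) + d - 1))
    (θ₀ : ℝ) (hθ₀ : 0 < θ₀) (hθ₀k : θ₀ < Real.pi / (2 * k)) :
    (∃ R₀ : ℝ, 0 < R₀ ∧ ∀ h : ℕ, h < k → IsUniformLocalBasin F U (localBasin d k h R₀ θ₀ β₀)) ∧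
    ∀ R₀ : ℝ, 0 < R₀ → ∀ h : ℕ, h < k →
      IsUniformLocalBasin F U (localBasin d k h R₀ θ₀ β₀) →
      (∀ z ∈ localBasin d k h R₀ θ₀ β₀,
        ∃ v : EuclideanSpace ℝ (Fin d),
          HasModulusDirection F z v ∧ ‖v‖ = 1 ∧ (∀ j, 0 < v j) ∧
          directionLimitSet F z = phaseTorus k h v ∧
          ConvergesTangentTo F z (realCone (phaseTorus k h v))) ∧
      (∀ v : EuclideanSpace ℝ (Fin d), ‖v‖ = 1 → (∀ j, 0 < v j) →
        ∃ z ∈ localBasin d k h R₀ θ₀ β₀, HasModulusDirection F z v) ∧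
      (⋃ z ∈ localBasin d k h R₀ θ₀ β₀, directionLimitSet F z) =
        {w : EuclideanSpace ℂ (Fin d) | ‖w‖ = 1 ∧ (∀ j, w j ≠ 0) ∧ ArgSumCongr k h w} := by
  -- For `d = 0` the convention `1 / 0 = 0` makes `0 < β₀ < 1 / d` contradictory.
  rcases Nat.eq_zero_or_pos d with rfl | hd
  · simp only [Nat.cast_zero, div_zero] at hβ₀d
    exact absurd hβ₀ hβ₀d.not_gt
  have : NeZero d := ⟨hd.ne'⟩
  have hβd : d * β₀ < 1 := by
    rwa [lt_div_iff₀ (by exact_mod_cast hd), mul_comm] at hβ₀d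
  have hprod := hres.prod_eq_one hlam
  obtain ⟨K, hK, R₁, hR₁, hstep⟩ := exists_stepEstimate hd hk hlam hprod (hU.mem_nhds hU0) hFN
    hβ₀ hβ₀d hβ₀l hθ₀ hθ₀k
  refine ⟨⟨R₁, by linarith, fun h _ => isUniformLocalBasin_localBasin hk hβ₀ hR₁ (hstep h)⟩, ?_⟩
  intro R₀ hR₀ h _ hbasin
  have hphase : ∀ z ∈ localBasin d k h R₁ θ₀ β₀, ∃ c : Fin d → ℂ, HasPhase lam F z c ∧
      (∀ j, ‖c j‖ = ‖z j‖ * Real.exp (errLog lam k F z j).re) ∧ (∀ j, c j ≠ 0) ∧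
      (∏ j, c j).arg = (sectorDir k h).arg := by
    intro z hz
    obtain ⟨c, hcn, ⟨t, ht, hct⟩, hc⟩ := exists_phase hd hk hθ₀k hR₁ hK hlam (hstep h) hz
    refine ⟨c, hc, hcn, fun j => ?_, by rw [hct, Complex.arg_real_mul _ ht]⟩
    rw [← norm_pos_iff, hcn]
    have := coordProd_ne_zero_iff.1 (coordProd_ne_zero_of_mem hk (by linarith) hz) j
    positivity
  have part1 : ∀ z ∈ localBasin d k h R₀ θ₀ β₀, ∃ v : EuclideanSpace ℝ (Fin d),
      HasModulusDirection F z v ∧ ‖v‖ = 1 ∧ (∀ j, 0 < v j) ∧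
      directionLimitSet F z = phaseTorus k h v ∧
      ConvergesTangentTo F z (realCone (phaseTorus k h v)) := by
    intro z hz
    have hz0 : Tendsto (fun n => F^[n] z) atTop (𝓝 0) := hbasin.2.2.tendsto_at hz
    obtain ⟨N, hN⟩ := (eventually_iterate_mem_localBasin hk hR₀ hθ₀ hθ₀k hd
      (fun n => hbasin.2.1.iterate n hz) hz0 R₁ (by linarith)).exists
    obtain ⟨c, hc, -, hc0, hca⟩ := hphase _ hN
    refine hc.of_iterate.conclusion hlam hres (fun j => mul_ne_zero (inv_ne_zero (pow_ne_zero _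
      fun h0 => by simpa [h0] using hlam j)) (hc0 j)) ?_ hz0
    rw [Finset.prod_mul_distrib, Finset.prod_inv_distrib, Finset.prod_pow, hprod, one_pow, inv_one,
      one_mul, hca]
  have part2 : ∀ v : EuclideanSpace ℝ (Fin d), ‖v‖ = 1 → (∀ j, 0 < v j) →
      ∃ z ∈ localBasin d k h R₀ θ₀ β₀, HasModulusDirection F z v := by
    intro v hv hv0
    -- The radius `max R₀ R₁` puts `z` in the given basin and also in the one where the estimates
    -- hold.
    obtain ⟨z, hz, s, hs, hzs⟩ := exists_mem_norm_mul_exp_eq hd hk hβ₀ hβd hθ₀ hθ₀k hR₁ hK hlam hF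
      (hstep h) (le_max_right R₀ R₁) hv0
    obtain ⟨c, hc, hcn, hc0, -⟩ :=
      hphase z (localBasin_subset hk (by linarith) (le_max_right R₀ R₁) hz)
    refine ⟨z, localBasin_subset hk hR₀ (le_max_left R₀ R₁) hz, ?_⟩
    have hcv : ∀ j, ‖c j‖ = s * v j := fun j => (hcn j).trans (hzs j)
    have hN : ‖(WithLp.toLp 2 c : EuclideanSpace ℂ (Fin d))‖ = s := by
      have h1 : ‖(WithLp.toLp 2 c : EuclideanSpace ℂ (Fin d))‖ = ‖s • v‖ := by
        rw [EuclideanSpace.norm_eq, EuclideanSpace.norm_eq]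
        congr 1
        refine Finset.sum_congr rfl fun j _ => ?_
        rw [PiLp.smul_apply, smul_eq_mul, Real.norm_of_nonneg (mul_nonneg hs.le (hv0 j).le), ← hcv]
      rw [h1, norm_smul, hv, mul_one, Real.norm_of_nonneg hs.le]
    convert hc.hasModulusDirection hlam hc0 using 1
    ext j
    simp only [hcv, hN]
    rw [mul_div_cancel_left₀ _ hs.ne']
  refine ⟨part1, part2, ?_⟩
  ext w
  simp only [Set.mem_iUnion, exists_prop]
  constructor
  · rintro ⟨z, hz, hw⟩
    obtain ⟨v, -, hv1, hv0, hset, -⟩ := part1 z hz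
    rw [hset] at hw
    obtain ⟨hwv, hwa⟩ := hw
    have hwj : ∀ j, ‖w j‖ = v j := fun j => by rw [← hwv]; rfl
    refine ⟨?_, fun j => ?_, hwa⟩
    · rw [← hv1, EuclideanSpace.norm_eq, EuclideanSpace.norm_eq]
      congr 1
      refine Finset.sum_congr rfl fun j _ => ?_
      rw [hwj, Real.norm_of_nonneg (hv0 j).le]
    · rw [← norm_pos_iff, hwj]
      exact hv0 j
  · rintro ⟨hw1, hw0, hwa⟩
    have hmn : ‖modulusVector w‖ = 1 := by
      rw [← hw1, EuclideanSpace.norm_eq, EuclideanSpace.norm_eq]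
      simp [modulusVector]
    obtain ⟨z, hz, hzv⟩ := part2 (modulusVector w) hmn fun j => norm_pos_iff.2 (hw0 j)
    obtain ⟨v, hv, -, -, hset, -⟩ := part1 z hz
    refine ⟨z, hz, ?_⟩
    rw [hset, tendsto_nhds_unique hv hzv]
    exact ⟨rfl, hwa⟩
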